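/- Definitions. Let $V_0=\mathbb N$ (a set of urelements), $V_{n+1}=V_n\cup\mathcal P(V_n)$ and $V=\bigcup_{n}V_n$. A nonstandard universe ${}^*V$ is the truncation at rank $\omega$ of an elementary extension $M$ of $(V,\in)$, that is, the collection of all $x\in M$ with $x\mathrel{{}^*\!\in}{}^*V_n$ for some $n\in\mathbb N$, such that ${}^*\mathbb N\setminus\mathbb N\neq\emptyset$. All nonstandard universes are assumed to be $\omega_1$-saturated: every countable family of internal sets (sets in ${}^*V$) with the finite intersection property has nonempty intersection. ${}^*V$ satisfies the $\aleph_0$-special model axiom if for every first-order language $L$ with fewer than $\aleph_0$ (that is, finitely many) non-logical symbols, every $L$-structure whose base set is an infinite internal set and whose relations and functions are internal is special. Here a structure $\mathfrak A$ is special if it is the union of an elementary chain $\langle\mathfrak A_\mu\rangle$, indexed by the cardinals $\mu<|\mathfrak A|$, such that each $\mathfrak A_\mu$ is $\mu^+$-saturated. For $H\in{}^*\mathbb N\setminus\mathbb N$ let $\Omega=\{1,\dots,H\}$ and, for internal $A\subseteq\Omega$, let $P(A)={}^*|A|/H$, where ${}^*|A|$ is the internal cardinality of $A$. The hyperfinite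 Loeb space $(\Omega,\Sigma,L_P)$ is the complete countably additive probability space generated by the finitely additive probability $\mathrm{st}\circ P$ on the algebra of internal subsets of $\Omega$ (the Carathéodory extension of $\mathrm{st}\circ P$). A probability space $(\Omega,\Sigma,P)$ is compact if there is a family $\mathcal C\subseteq\Sigma$ such that every $\mathcal D\subseteq\mathcal C$ with the finite intersection property satisfies $\bigcap\mathcal D\neq\emptyset$, and such that $P(A)=\sup\{P(C):C\in\mathcal C,\ C\subseteq A\}$ for every $A\in\Sigma$. Let $\nu_\omega$ be the (completed) fair coin-tossing product measure on ${}^\omega2$. Theorem. Let $\kappa>\omega$ be a regular cardinal for which there is an increasing sequence $\langle Z_\alpha\subseteq{}^\omega2:\alpha<\kappa\rangle$ (that is, $Z_\alpha\subseteq Z_\beta$ for $\alpha\le\beta<\kappa$) with $\nu_\omega(Z_\alpha)=0$ for every $\alpha<\kappa$ and ${}^\omega2=\bigcup_{\alpha<\kappa}Z_\alpha$. Let $\lambda$ be a strong limit cardinal with $\mathrm{cf}(\lambda)=\kappa$. Suppose that ${}^*V$ is a nonstandard universe that satisfies the $\aleph_0$-special model axiom and that $|{}^*\mathbb N|=\lambda$.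 Then every hyperfinite Loeb space in ${}^*V$ is compact. -/

import Mathlib

open FirstOrder.Language FirstOrder.Language.Structure
open scoped FirstOrder Cardinal
open MeasureTheory

universe u

namespace Loeb



/-! ### The standard universe: the superstructure over the set of urelements `ℕ` -/

/-- The relation symbols of the language of set theory: one binary symbol. -/
inductive MemRel : ℕ → Type
  | mem : MemRel 2

/-- The first-order language of set theory. -/
def memLang : FirstOrder.Language.{0, 0} := ⟨fun _ => Empty, MemRel⟩

/-- The membership relation of a structure for the language of set theory. -/
def Mem {X : Type*} [memLang.Structure X] (x y : X) : Prop :=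
  RelMap (L := memLang) MemRel.mem ![x, y]

/-- The `n`-th level `V n` of the superstructure: `V 0 = ℕ` and `V (n + 1) = V n ∪ 𝒫 (V n)`.
Every set in `V n` is a subset of `V n`, so that `V (n + 1)` is the disjoint union of the set `ℕ`
of urelements with the power set of `V n`. -/
def Level : ℕ → Type
  | 0 => ℕ
  | n + 1 => ℕ ⊕ Set (Level n)

/-- The urelement `k` as an element of `V n`. -/
def Level.urel : (n : ℕ) → ℕ → Level n
  | 0, k => k
  | _ + 1, k => Sum.inl k

/-- A subset of `V n` as an element of `V (n + 1)`. -/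
def Level.ofSet {n : ℕ} (s : Set (Level n)) : Level (n + 1) := Sum.inr s

/-- The inclusion of `V n` in `V (n + 1)`. -/
def Level.lift : (n : ℕ) → Level n → Level (n + 1)
  | 0, k => Sum.inl k
  | _ + 1, Sum.inl k => Sum.inl k
  | n + 1, Sum.inr s => Sum.inr (Level.lift n '' s)

/-- Membership between elements of `V n`; urelements have no elements. -/
def Level.Mem : (n : ℕ) → Level n → Level n → Prop
  | 0, _, _ => False
  | _ + 1, _, Sum.inl _ => False
  | n + 1, x, Sum.inr s => ∃ y ∈ s, Level.lift n y = x

instance (n : ℕ) : memLang.Structure (Level n) where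
  funMap f := nomatch f
  RelMap | MemRel.mem => fun v => Level.Mem n (v 0) (v 1)

theorem Level.lift_injective : ∀ n, Function.Injective (Level.lift n)
  | 0 => fun _ _ h => Sum.inl.inj h
  | n + 1 => by
      rintro (a | s) (b | t) h
      · exact congrArg Sum.inl (Sum.inl.inj h)
      · cases h
      · cases h
      · exact congrArg Sum.inr ((Level.lift_injective n).image_injective (Sum.inr.inj h))

theorem Level.mem_lift : ∀ n (x y : Level n),
    Level.Mem (n + 1) (Level.lift n x) (Level.lift n y) ↔ Level.Mem n x y
  | 0, _, _ => Iff.rfl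
  | _ + 1, _, Sum.inl _ => Iff.rfl
  | n + 1, x, Sum.inr s => by
      constructor
      · rintro ⟨z, ⟨w, hw, rfl⟩, h⟩
        exact ⟨w, hw, Level.lift_injective (n + 1) h⟩
      · rintro ⟨w, hw, rfl⟩
        exact ⟨Level.lift n w, ⟨w, hw, rfl⟩, rfl⟩

/-- The inclusion of `V n` in `V (n + 1)` as an embedding of `∈`-structures. -/
def Level.emb (n : ℕ) : Level n ↪[memLang] Level (n + 1) where
  toFun := Level.lift n
  inj' := Level.lift_injective n
  map_fun' f := nomatch f
  map_rel' := by
    rintro _ ⟨⟩ v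
    exact Level.mem_lift n (v 0) (v 1)

/-- The standard universe `V = ⋃ n, V n`, with its membership relation, as the union (direct
limit) of the chain of the `V n`. -/
abbrev Std : Type :=
  FirstOrder.Language.DirectLimit Level (DirectedSystem.natLERec Level.emb)

/-- An element of `V n` as an element of `V`. -/
noncomputable def Level.toStd (n : ℕ) (x : Level n) : Std :=
  FirstOrder.Language.DirectLimit.of memLang ℕ Level (DirectedSystem.natLERec Level.emb) n x

/-- The set `V n` as an element of `V`. In particular `stdLevel 0` is the set `ℕ`. -/
noncomputable def stdLevel (n : ℕ) : Std :=
  Level.toStd (n + 1) (Level.ofSet Set.univ)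

/-- The natural number `k` as an element (a urelement) of `V`. -/
noncomputable def stdNat (k : ℕ) : Std :=
  Level.toStd 0 (Level.urel 0 k)

/-- The empty set as an element of `V`. -/
noncomputable def stdEmpty : Std :=
  Level.toStd 1 (Level.ofSet ∅)

/-- The Kuratowski pair `{{x}, {x, y}}`. -/
def Level.pair {n : ℕ} (x y : Level n) : Level (n + 2) :=
  Level.ofSet {Level.ofSet {x}, Level.ofSet {x, y}}

/-- A binary relation on `ℕ`, as a set of ordered pairs in `V`. -/
noncomputable def stdRel (R : ℕ → ℕ → Prop) : Std :=
  Level.toStd 3 (Level.ofSet {p | ∃ a b : ℕ, R a b ∧ p = Level.pair (Level.urel 0 a) (Level.urel 0 b)})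

/-- The function assigning to each finite subset of `ℕ` its number of elements, as a set of ordered
pairs in `V`. -/
noncomputable def stdCard : Std :=
  Level.toStd 4 (Level.ofSet {p | ∃ A : Finset ℕ,
    p = Level.pair (Level.ofSet (Level.urel 0 '' (A : Set ℕ))) (Level.urel 1 A.card)})

theorem mem_stdLevel (x : Std) : ∃ n, Mem x (stdLevel n) := by
  obtain ⟨n, a, rfl⟩ := FirstOrder.Language.DirectLimit.exists_of x
  refine ⟨n, ?_⟩
  have h : Mem (X := Level (n + 1)) (Level.lift n a) (Level.ofSet Set.univ) :=
    ⟨a, Set.mem_univ a, rfl⟩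
  have e : FirstOrder.Language.DirectLimit.of memLang ℕ Level (DirectedSystem.natLERec Level.emb) n a =
      Level.toStd (n + 1) (Level.lift n a) := by
    rw [← FirstOrder.Language.DirectLimit.of_f (hij := Nat.le_succ n)]
    change _ = FirstOrder.Language.DirectLimit.of memLang ℕ Level (DirectedSystem.natLERec Level.emb) (n + 1) _
    congr 1
    rw [DirectedSystem.coe_natLERec]
    exact Nat.leRecOn_succ' _
  rw [e]
  have h2 := ((FirstOrder.Language.DirectLimit.of memLang ℕ Level (DirectedSystem.natLERec Level.emb)
    (n + 1)).map_rel MemRel.mem ![Level.lift n a, Level.ofSet Set.univ]).2 h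
  unfold Mem
  convert h2 using 1
  funext i
  fin_cases i <;> rfl

/-! ### Nonstandard universes -/

section Nonstandard

variable {M : Type u} [memLang.Structure M] (j : Std ↪ₑ[memLang] M)

/-- The truncation at rank `ω` of an elementary extension `j : V → M` of the standard universe: the
elements of `M` that belong to `*(V n)` for some standard `n`. These are the objects of the
nonstandard universe `*V`, that is, the internal objects. -/
abbrev NSU : Type u := {x : M // ∃ n : ℕ, Mem x (j (stdLevel n))}

variable {j}

/-- The membership relation of the nonstandard universe. -/
def NSU.mem (x y : NSU j) : Prop := Mem x.1 y.1

variable (j) in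
/-- The nonstandard version `*v` of a standard object `v`. -/
noncomputable def star (v : Std) : NSU j :=
  ⟨j v, by
    obtain ⟨n, hn⟩ := mem_stdLevel v
    refine ⟨n, ?_⟩
    have h := (j.map_rel (MemRel.mem : memLang.Relations 2) ![v, stdLevel n]).2 hn
    unfold Mem
    convert h using 1
    funext i
    fin_cases i <;> rfl⟩

variable (j) in
/-- The set `*ℕ`, as an internal set. -/
noncomputable def starNat : NSU j := star j (stdLevel 0)

/-- The external set of the elements of an internal set. -/
abbrev NSU.El (A : NSU j) : Type u := {x : NSU j // x.mem A}

/-- A hyperfinite integer: an element of `*ℕ ∖ ℕ`. -/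
def IsHyperfinite (H : NSU j) : Prop :=
  H.mem (starNat j) ∧ ∀ k : ℕ, H ≠ star j (stdNat k)

variable (j) in
/-- `*V` is a nonstandard universe in the proper sense, `*ℕ ∖ ℕ ≠ ∅`, and it is `ω₁`-saturated:
every countable family of internal sets with the finite intersection property has nonempty
intersection. -/
structure IsSaturatedNSU : Prop where
  exists_hyperfinite : ∃ H : NSU j, IsHyperfinite H
  saturated : ∀ A : ℕ → NSU j,
    (∀ n, ∃ x : NSU j, ∀ i ≤ n, x.mem (A i)) → ∃ x : NSU j, ∀ i, x.mem (A i)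

/-- `z` is the internal Kuratowski pair `{{x}, {x, y}}`. -/
def IsPair (z x y : NSU j) : Prop :=
  ∃ a b : NSU j, (∀ w, w.mem a ↔ w = x) ∧ (∀ w, w.mem b ↔ w = x ∨ w = y) ∧
    ∀ w, w.mem z ↔ w = a ∨ w = b

/-- `z` is the internal ordered tuple with the given list of entries. -/
def IsTuple : List (NSU j) → NSU j → Prop
  | [], z => z = star j stdEmpty
  | [x], z => z = x
  | x :: y :: l, z => ∃ t, IsTuple (y :: l) t ∧ IsPair z x t

/-! ### The special model axiom -/

/-- An `n`-ary relation on an internal set `A` is internal: it is cut out on `A ^ n` by an internal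
set of tuples. -/
def IsInternalRel {A : NSU j} {n : ℕ} (R : (Fin n → A.El) → Prop) : Prop :=
  ∃ g : NSU j, ∀ v : Fin n → A.El,
    R v ↔ ∃ t : NSU j, IsTuple (List.ofFn fun i => (v i).1) t ∧ t.mem g

/-- An `L`-structure on an internal base set is internally presented if the interpretations of
all relation symbols and (the graphs of) those of all function symbols are internal. -/
def IsInternallyPresented (L : FirstOrder.Language.{0, 0}) (A : NSU j) [L.Structure A.El] : Prop :=
  (∀ (n : ℕ) (r : L.Relations n), IsInternalRel fun v : Fin n → A.El => RelMap r v) ∧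
  ∀ (n : ℕ) (f : L.Functions n),
    IsInternalRel fun v : Fin (n + 1) → A.El => funMap f (Fin.init v) = v (Fin.last n)

end Nonstandard

/-- A structure `N` is `κ`-saturated: for every set `X` of fewer than `κ` parameters, every type in
one variable over `X` (a set of formulas with parameters in `X` that is finitely satisfiable in `N`)
is realized in `N`. -/
def IsSaturatedModel (L : FirstOrder.Language.{0, 0}) (N : Type u) [L.Structure N] (κ : Cardinal.{u}) : Prop :=
  ∀ X : Set N, #X < κ → ∀ Γ : Set (L.Formula (X ⊕ Unit)),
    (∀ Δ : Finset (L.Formula (X ⊕ Unit)), (Δ : Set (L.Formula (X ⊕ Unit))) ⊆ Γ →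
      ∃ a : N, ∀ φ ∈ Δ, φ.Realize (Sum.elim (fun x : X => (x : N)) fun _ => a)) →
    ∃ a : N, ∀ φ ∈ Γ, φ.Realize (Sum.elim (fun x : X => (x : N)) fun _ => a)

/-- A structure `N` is special: it is the union of an elementary chain of structures `C μ`, where
`μ` ranges over the cardinals below the cardinality of `N`, such that each `C μ` is
`μ⁺`-saturated. -/
def IsSpecial (L : FirstOrder.Language.{0, 0}) (N : Type u) [L.Structure N] : Prop :=
  ∃ C : Cardinal.{u} → L.ElementarySubstructure N,
    (∀ μ ν : Cardinal.{u}, μ ≤ ν → ν < #N → C μ ≤ C ν) ∧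
    (∀ x : N, ∃ μ < #N, x ∈ C μ) ∧
    ∀ μ < #N, IsSaturatedModel L (C μ) (Order.succ μ)

/-- The `κ`-special model axiom: for every first-order language `L` with fewer than `κ` symbols,
every internally presented `L`-structure with infinite base set is special. -/
def SpecialModelAxiom {M : Type u} [memLang.Structure M] (j : Std ↪ₑ[memLang] M)
    (κ : Cardinal.{0}) : Prop :=
  ∀ L : FirstOrder.Language.{0, 0}, L.card < κ → ∀ (A : NSU j) [Infinite A.El] [L.Structure A.El],
    IsInternallyPresented L A → IsSpecial L A.El

/-! ### Hyperfinite Loeb spaces -/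

section LoebSpace

variable {M : Type u} [memLang.Structure M] {j : Std ↪ₑ[memLang] M}

/-- The nonstandard version `*R` of a binary relation `R` on `ℕ`. -/
def StarRel (R : ℕ → ℕ → Prop) (x y : NSU j) : Prop :=
  ∃ p : NSU j, IsPair p x y ∧ p.mem (star j (stdRel R))

/-- `c` is the internal cardinality of `A`, for `A` an internal hyperfinite (or finite) subset of
`*ℕ`. -/
def HasInternalCard (A c : NSU j) : Prop :=
  ∃ p : NSU j, IsPair p A c ∧ p.mem (star j stdCard)

/-- The external point set `{1, …, H}` of the hyperfinite space. -/
def Omega (H : NSU j) : Type u := {x : NSU j // StarRel (fun a b => 1 ≤ a ∧ a ≤ b) x H}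

/-- The standard part of the hyperrational number `c / H`, for `c, H ∈ *ℕ` with `c ≤ H` and
`0 < H`: the supremum of the standard rationals `p / q ≥ 0` with `p * H ≤ q * c`. -/
noncomputable def stRatio (c H : NSU j) : ℝ :=
  sSup {r : ℝ | ∃ p q : ℕ, 0 < q ∧ r = p / q ∧ StarRel (fun h a => p * h ≤ q * a) H c}

/-- `A` is an internal subset of `{1, …, H}` and its set of points is `S`. -/
def Represents {H : NSU j} (A : NSU j) (S : Set (Omega H)) : Prop :=
  (∀ x : NSU j, x.mem A → StarRel (fun a b => 1 ≤ a ∧ a ≤ b) x H) ∧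
    ∀ x : Omega H, x ∈ S ↔ x.1.mem A

/-- The standard part of the internal counting probability `P A = *|A| / H`, as a set function: its
value at the set of points of an internal set `A` is `st (*|A| / H)`, and its value at any set that
is not internal is `∞`. -/
noncomputable def internalProb (H : NSU j) (S : Set (Omega H)) : ENNReal :=
  ⨅ (A : NSU j) (c : NSU j) (_ : Represents A S ∧ HasInternalCard A c),
    ENNReal.ofReal (stRatio c H)

/-- The outer measure generated by `st ∘ P`: the infimum of the sums `∑ n, st (P (A n))` over
all countable covers by internal sets `A n`. -/
noncomputable def loebOuter (H : NSU j) : OuterMeasure (Omega H) :=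
  OuterMeasure.boundedBy (internalProb H)

/-- The Loeb `σ`-algebra: the Carathéodory measurable sets of the outer measure, which form the
completion of the `σ`-algebra generated by the internal sets. -/
noncomputable instance loebSpace (H : NSU j) : MeasurableSpace (Omega H) :=
  (loebOuter H).caratheodory

/-- The Loeb measure: the Carathéodory extension of `st ∘ P`. -/
noncomputable def loebMeasure (H : NSU j) : Measure (Omega H) :=
  (loebOuter H).toMeasure le_rfl

end LoebSpace

/-! ### Compact measure spaces -/

/-- A family of sets is compact if every subfamily with the finite intersection property has
nonempty intersection. -/
def IsCompactFamily {X : Type*} (C : Set (Set X)) : Prop :=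
  ∀ D ⊆ C, (∀ F ⊆ D, F.Finite → (⋂₀ F).Nonempty) → (⋂₀ D).Nonempty

/-- A measure space is compact if there is a compact family of measurable sets that is
inner-regular: every measurable set has the supremum of the measures of its subsets in the family
as its measure. -/
def IsCompactMeasure {X : Type*} [MeasurableSpace X] (P : Measure X) : Prop :=
  ∃ C : Set (Set X), (∀ S ∈ C, MeasurableSet S) ∧ IsCompactFamily C ∧
    ∀ A : Set X, MeasurableSet A → P A = ⨆ S ∈ {S | S ∈ C ∧ S ⊆ A}, P S

/-- The fair coin-tossing measure on `2 ^ ω`. -/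
noncomputable def coinMeasure : Measure (ℕ → Bool) :=
  Measure.infinitePi fun _ => (PMF.uniformOfFintype Bool).toMeasure

end Loeb

namespace Loeb

/-! ### Elements of the standard universe -/

/-! Internal subsets of `{1, …, H}` are coded by elements of `*ℕ` through binary expansions, so the
internal combinatorics lives in one structure: `*ℕ` with the relation `InBits`. This structure is
internally presented and hence special. Since it has cardinality `lam` of cofinality `κ`, every code
receives a rank below `κ.ord` such that any family of codes of bounded rank with the finite
intersection property has a common element (`exists_rank_of_special`).

Families of unbounded rank are excluded by means of the null sets. Reading off the standard binary
digits of a point maps the Loeb space to the Cantor space, and a count of the numbers with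
prescribed first digits shows that the image measure is at most twice the coin measure on cylinders.
Hence each `Z α` is null for the image measure (`absolutelyContinuous_map_digits`). The compact
family consists of the measurable intersections of coded sets of rank at most `α` that `digits` maps
into a closed set disjoint from `Z α`.

Compactness (`isCompactFamily_compactFamily`): if the `α` attached to the members of a subfamily
were unbounded, compactness of the Cantor space would give a point in all the closed sets; it lies
in some `Z β`, hence in `Z α` for a member with `α > β`, a contradiction. So they are bounded, and
saturation yields a common point.

Inner regularity (`exists_compactFamily_subset`): the complement of a measurable set is covered
efficiently by countably many coded sets. As `κ` is regular and uncountable, countably many codes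
have ranks below a single `α`. Cutting down to a closed set that avoids `Z α` costs arbitrarily
little measure. -/

theorem toStd_lift (n : ℕ) (x : Level n) :
    Level.toStd (n + 1) (Level.lift n x) = Level.toStd n x := by
  symm
  unfold Level.toStd
  rw [← FirstOrder.Language.DirectLimit.of_f (hij := Nat.le_succ n)]
  congr 1
  rw [DirectedSystem.coe_natLERec]
  exact Nat.leRecOn_succ' _

theorem toStd_injective (n : ℕ) : Function.Injective (Level.toStd n) :=
  (FirstOrder.Language.DirectLimit.of memLang ℕ Level
    (DirectedSystem.natLERec Level.emb) n).injective

theorem toStd_inj {n : ℕ} {x y : Level n} : Level.toStd n x = Level.toStd n y ↔ x = y :=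
  (toStd_injective n).eq_iff

theorem mem_toStd {n : ℕ} {x y : Level n} :
    Mem (Level.toStd n x) (Level.toStd n y) ↔ Level.Mem n x y := by
  have h := (FirstOrder.Language.DirectLimit.of memLang ℕ Level
    (DirectedSystem.natLERec Level.emb) n).map_rel MemRel.mem ![x, y]
  rw [show Level.Mem n x y ↔ RelMap (L := memLang) MemRel.mem ![x, y] from Iff.rfl, ← h]
  unfold Mem
  convert Iff.rfl using 2
  funext i
  fin_cases i <;> rfl

theorem exists_toStd (x : Std) : ∃ n a, x = Level.toStd n a := by
  obtain ⟨n, a, rfl⟩ := FirstOrder.Language.DirectLimit.exists_of x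
  exact ⟨n, a, rfl⟩

theorem exists_toStd_of_le {n m : ℕ} (h : n ≤ m) (a : Level n) :
    ∃ b, Level.toStd n a = Level.toStd m b := by
  induction h with
  | refl => exact ⟨a, rfl⟩
  | step _ ih =>
    obtain ⟨b, hb⟩ := ih
    exact ⟨Level.lift _ b, by rw [toStd_lift, hb]⟩

theorem toStd_urel (n k : ℕ) : Level.toStd n (Level.urel n k) = stdNat k := by
  induction n with
  | zero => rfl
  | succ n ih =>
    rw [← ih, ← toStd_lift n]
    cases n <;> rfl

theorem stdNat_injective : Function.Injective stdNat := toStd_injective 0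

@[simp] theorem stdNat_inj {a b : ℕ} : stdNat a = stdNat b ↔ a = b := stdNat_injective.eq_iff

/-- Passing to a higher level adds no elements to a set. The induction strips one `Level.lift` at a
time from both the set and its element. -/
theorem exists_mem_of_mem_toStd {n m : ℕ} (h : n + 1 ≤ m) {s : Set (Level n)} {x b : Level m}
    (hb : Level.toStd m b = Level.toStd (n + 1) (Level.ofSet s)) (hx : Level.Mem m x b) :
    ∃ a ∈ s, Level.toStd m x = Level.toStd n a := by
  induction m, h using Nat.le_induction with
  | base =>
    rw [toStd_inj] at hb
    subst hb
    obtain ⟨a, ha, rfl⟩ := hx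
    exact ⟨a, ha, toStd_lift n a⟩
  | succ m hm ih =>
    obtain ⟨b', hb'⟩ := exists_toStd_of_le hm (Level.ofSet s)
    have : b = Level.lift m b' := by
      rw [← toStd_inj, hb, hb', toStd_lift]
    subst this
    obtain ⟨m, rfl⟩ : ∃ k, m = k + 1 := ⟨m - 1, by omega⟩
    rcases b' with k | t
    · exact hx.elim
    · obtain ⟨_, ⟨c, hc, rfl⟩, rfl⟩ := hx
      rw [toStd_lift]
      exact ih hb'.symm ⟨c, hc, rfl⟩

theorem mem_toStd_ofSet {n : ℕ} {s : Set (Level n)} {x : Std} :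
    Mem x (Level.toStd (n + 1) (Level.ofSet s)) ↔ ∃ a ∈ s, x = Level.toStd n a := by
  constructor
  · intro h
    obtain ⟨m, a, rfl⟩ := exists_toStd x
    obtain ⟨b, hb⟩ := exists_toStd_of_le (le_max_left m (n + 1)) a
    obtain ⟨c, hc⟩ := exists_toStd_of_le (le_max_right m (n + 1)) (Level.ofSet s)
    rw [hb, hc, mem_toStd] at h
    rw [hb]
    exact exists_mem_of_mem_toStd (le_max_right m (n + 1)) hc.symm h
  · rintro ⟨a, ha, rfl⟩
    rw [← toStd_lift, mem_toStd]
    exact ⟨a, ha, rfl⟩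

theorem not_mem_stdNat {k : ℕ} {x : Std} : ¬ Mem x (stdNat k) := by
  intro h
  obtain ⟨m, a, rfl⟩ := exists_toStd x
  rw [← toStd_urel m, mem_toStd] at h
  cases m <;> exact h

theorem mem_stdLevel_zero {x : Std} : Mem x (stdLevel 0) ↔ ∃ k, x = stdNat k := by
  rw [stdLevel, mem_toStd_ofSet]
  simp only [Set.mem_univ, true_and]
  rfl

/-- Transitivity of the levels; its transfer makes the truncation `NSU j` a transitive part of `M`.
-/
theorem mem_stdLevel_of_mem {n : ℕ} {x y : Std} (hx : Mem x y) (hy : Mem y (stdLevel n)) :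
    Mem x (stdLevel n) := by
  rw [stdLevel, mem_toStd_ofSet] at *
  obtain ⟨b, -, rfl⟩ := hy
  cases n with
  | zero => exact (not_mem_stdNat hx).elim
  | succ n =>
    rcases b with k | s
    · exact (not_mem_stdNat (k := k) (by rwa [← toStd_urel (n + 1)])).elim
    · obtain ⟨a, -, rfl⟩ := mem_toStd_ofSet.1 hx
      exact ⟨Level.lift n a, trivial, (toStd_lift n a).symm⟩

/-! ### Ordered pairs -/

/-- `p` is the Kuratowski pair of `x` and `y` in a structure for the language of set theory. -/
def PairOn {X : Type*} [memLang.Structure X] (p x y : X) : Prop :=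
  ∃ a b : X, (∀ w, Mem w a ↔ w = x) ∧ (∀ w, Mem w b ↔ w = x ∨ w = y) ∧
    ∀ w, Mem w p ↔ w = a ∨ w = b

/-- The pair of `x` and `y` is an element of `r`. -/
def RelOn {X : Type*} [memLang.Structure X] (x y r : X) : Prop :=
  ∃ p : X, PairOn p x y ∧ Mem p r

/-- The usual Kuratowski argument, arranged to compare elements only, since extensionality is not
assumed of `X`. -/
theorem PairOn.unique {X : Type*} [memLang.Structure X] {p x y x' y' : X}
    (h : PairOn p x y) (h' : PairOn p x' y') : x = x' ∧ y = y' := by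
  obtain ⟨a, b, ha, hb, hp⟩ := h
  obtain ⟨a', b', ha', hb', hp'⟩ := h'
  have h1 : a = a' ∨ a = b' := (hp' a).1 ((hp a).2 (Or.inl rfl))
  have h2 : b = a' ∨ b = b' := (hp' b).1 ((hp b).2 (Or.inr rfl))
  have h3 : a' = a ∨ a' = b := (hp a').1 ((hp' a').2 (Or.inl rfl))
  have h4 : b' = a ∨ b' = b := (hp b').1 ((hp' b').2 (Or.inr rfl))
  have hx : x = x' := by
    rcases h1 with rfl | rfl
    · exact (ha' x).1 ((ha x).2 rfl)
    · exact ((ha x').1 ((hb' x').2 (Or.inl rfl))).symm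
  subst hx
  refine ⟨rfl, ?_⟩
  have e1 := hb y
  have e2 := hb' y'
  simp only [or_true, iff_true] at e1 e2
  have k1 : y = x ∨ y = y' := by
    rcases h2 with rfl | rfl
    · exact Or.inl ((ha' y).1 e1)
    · exact (hb' y).1 e1
  have k2 : y' = x ∨ y' = y := by
    rcases h4 with rfl | rfl
    · exact Or.inl ((ha y').1 e2)
    · exact (hb y').1 e2
  rcases k1 with k1 | k1
  · rcases k2 with k2 | k2
    · rw [k1, k2]
    · exact k2.symm
  · exact k1

theorem pairOn_toStd {n : ℕ} (a b : Level n) :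
    PairOn (Level.toStd (n + 2) (Level.pair a b)) (Level.toStd n a) (Level.toStd n b) := by
  refine ⟨Level.toStd (n + 1) (Level.ofSet {a}), Level.toStd (n + 1) (Level.ofSet {a, b}),
    fun w => ?_, fun w => ?_, fun w => ?_⟩
  · rw [mem_toStd_ofSet]; simp
  · rw [mem_toStd_ofSet]; simp
  · rw [Level.pair, mem_toStd_ofSet]; simp

theorem pairOn_toStd_iff {n : ℕ} {a b : Level n} {x y : Std} :
    PairOn (Level.toStd (n + 2) (Level.pair a b)) x y ↔
      x = Level.toStd n a ∧ y = Level.toStd n b := by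
  constructor
  · intro h
    exact h.unique (pairOn_toStd a b)
  · rintro ⟨rfl, rfl⟩
    exact pairOn_toStd a b

theorem relOn_stdRel {R : ℕ → ℕ → Prop} {x y : Std} :
    RelOn x y (stdRel R) ↔ ∃ a b, R a b ∧ x = stdNat a ∧ y = stdNat b := by
  constructor
  · rintro ⟨p, hp, hm⟩
    obtain ⟨_, ⟨a, b, hR, rfl⟩, rfl⟩ := mem_toStd_ofSet.1 hm
    exact ⟨a, b, hR, pairOn_toStd_iff.1 hp⟩
  · rintro ⟨a, b, hR, rfl, rfl⟩
    exact ⟨_, pairOn_toStd (n := 0) a b, mem_toStd_ofSet.2 ⟨_, ⟨a, b, hR, rfl⟩, rfl⟩⟩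

/-- A finite set of natural numbers as an element of `V`. -/
noncomputable def stdFinset (F : Finset ℕ) : Std :=
  Level.toStd 1 (Level.ofSet (Level.urel 0 '' (F : Set ℕ)))

theorem mem_stdFinset {F : Finset ℕ} {x : Std} :
    Mem x (stdFinset F) ↔ ∃ k ∈ F, x = stdNat k := by
  rw [stdFinset, mem_toStd_ofSet]
  simp only [Set.mem_image, Finset.mem_coe, exists_exists_and_eq_and]
  rfl

theorem relOn_stdCard {x y : Std} :
    RelOn x y stdCard ↔ ∃ F : Finset ℕ, x = stdFinset F ∧ y = stdNat F.card := by
  constructor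
  · rintro ⟨p, hp, hm⟩
    obtain ⟨_, ⟨F, rfl⟩, rfl⟩ := mem_toStd_ofSet.1 hm
    obtain ⟨hx, hy⟩ := pairOn_toStd_iff.1 hp
    exact ⟨F, hx, hy.trans (toStd_urel 1 _)⟩
  · rintro ⟨F, rfl, rfl⟩
    rw [← toStd_urel 1]
    exact ⟨_, pairOn_toStd _ _, mem_toStd_ofSet.2 ⟨_, ⟨F, rfl⟩, rfl⟩⟩

/-! ### Transfer -/

/-- The atomic formula `x ∈ y`. -/
def memForm {α : Type*} {n : ℕ} (x y : memLang.Term (α ⊕ Fin n)) : memLang.BoundedFormula α n :=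
  FirstOrder.Language.Relations.boundedFormula₂ (MemRel.mem : memLang.Relations 2) x y

@[simp] theorem realize_memForm {X : Type*} [memLang.Structure X] {α : Type*} {n : ℕ}
    {x y : memLang.Term (α ⊕ Fin n)} {v : α → X} {xs : Fin n → X} :
    (memForm x y).Realize v xs ↔ Mem (x.realize (Sum.elim v xs)) (y.realize (Sum.elim v xs)) :=
  FirstOrder.Language.BoundedFormula.realize_rel₂

/-- The formula expressing that the pair of the first two variables belongs to the third. -/
def relForm : memLang.Formula (Fin 3) :=
  let v : ∀ {n : ℕ}, Fin 3 → memLang.Term (Fin 3 ⊕ Fin n) :=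
    fun i => FirstOrder.Language.Term.var (Sum.inl i)
  ∃' (∃' (∃' (∀' ((memForm (&3) (&1)).iff ((&3).bdEqual (v 0))) ⊓
    (∀' ((memForm (&3) (&2)).iff ((&3).bdEqual (v 0) ⊔ (&3).bdEqual (v 1))) ⊓
    ∀' ((memForm (&3) (&0)).iff ((&3).bdEqual (&1) ⊔ (&3).bdEqual (&2)))))) ⊓
    memForm (&0) (v 2))

theorem realize_relForm {X : Type*} [memLang.Structure X] {v : Fin 3 → X} :
    relForm.Realize v ↔ RelOn (v 0) (v 1) (v 2) := by
  simp [relForm, RelOn, PairOn, FirstOrder.Language.Formula.Realize, Fin.snoc]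

/-- Formulas about the nonstandard universe with named variables, in which the sets of natural
numbers, all binary relations between them and the finite cardinality occur as primitives. -/
inductive Fm : Type
  | mem (i k : ℕ)
  | eq (i k : ℕ)
  | rel (R : ℕ → ℕ → Prop) (i k : ℕ)
  | card (i k : ℕ)
  | fls
  | imp (φ ψ : Fm)
  | all (k : ℕ) (φ : Fm)
  | allNat (k : ℕ) (φ : Fm)

namespace Fm

/-- Negation. -/
def neg (φ : Fm) : Fm := φ.imp fls

/-- Conjunction. -/
def and (φ ψ : Fm) : Fm := (φ.imp ψ.neg).neg

/-- Equivalence. -/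
def iff (φ ψ : Fm) : Fm := (φ.imp ψ).and (ψ.imp φ)

/-- Existential quantification. -/
def ex (k : ℕ) (φ : Fm) : Fm := (all k φ.neg).neg

/-- Existential quantification over the natural numbers. -/
def exNat (k : ℕ) (φ : Fm) : Fm := (allNat k φ.neg).neg

/-- The meaning of a formula in the standard universe. -/
def evalStd : Fm → (ℕ → Std) → Prop
  | mem i k, v => Mem (v i) (v k)
  | eq i k, v => v i = v k
  | rel R i k, v => ∃ a b, R a b ∧ v i = stdNat a ∧ v k = stdNat b
  | card i k, v => ∃ F : Finset ℕ, v i = stdFinset F ∧ v k = stdNat F.card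
  | fls, _ => False
  | imp φ ψ, v => φ.evalStd v → ψ.evalStd v
  | all k φ, v => ∀ x, φ.evalStd (Function.update v k x)
  | allNat k φ, v => ∀ n : ℕ, φ.evalStd (Function.update v k (stdNat n))

/-- The meaning of a formula in an elementary extension of the standard universe. -/
def eval {M : Type u} [memLang.Structure M] (j : Std ↪ₑ[memLang] M) : Fm → (ℕ → M) → Prop
  | mem i k, v => Mem (v i) (v k)
  | eq i k, v => v i = v k
  | rel R i k, v => RelOn (v i) (v k) (j (stdRel R))
  | card i k, v => RelOn (v i) (v k) (j stdCard)
  | fls, _ => False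
  | imp φ ψ, v => φ.eval j v → ψ.eval j v
  | all k φ, v => ∀ x, φ.eval j (Function.update v k x)
  | allNat k φ, v => ∀ x, Mem x (j (stdLevel 0)) → φ.eval j (Function.update v k x)

section

variable {v : ℕ → Std} {φ ψ : Fm} {k : ℕ}

@[simp] theorem evalStd_neg : φ.neg.evalStd v ↔ ¬ φ.evalStd v := Iff.rfl

@[simp] theorem evalStd_and : (φ.and ψ).evalStd v ↔ φ.evalStd v ∧ ψ.evalStd v := by
  simp [and, evalStd]

@[simp] theorem evalStd_iff : (φ.iff ψ).evalStd v ↔ (φ.evalStd v ↔ ψ.evalStd v) := by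
  simp [iff, evalStd, iff_def]

@[simp] theorem evalStd_ex : (φ.ex k).evalStd v ↔ ∃ x, φ.evalStd (Function.update v k x) := by
  simp [ex, evalStd]

@[simp] theorem evalStd_exNat :
    (φ.exNat k).evalStd v ↔ ∃ n : ℕ, φ.evalStd (Function.update v k (stdNat n)) := by
  simp [exNat, evalStd]

end

section

variable {M : Type u} [memLang.Structure M] {j : Std ↪ₑ[memLang] M}
  {v : ℕ → M} {φ ψ : Fm} {k : ℕ}

@[simp] theorem eval_neg : φ.neg.eval j v ↔ ¬ φ.eval j v := Iff.rfl

@[simp] theorem eval_and : (φ.and ψ).eval j v ↔ φ.eval j v ∧ ψ.eval j v := by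
  simp [and, eval]

@[simp] theorem eval_iff : (φ.iff ψ).eval j v ↔ (φ.eval j v ↔ ψ.eval j v) := by
  simp [iff, eval, iff_def]

@[simp] theorem eval_ex : (φ.ex k).eval j v ↔ ∃ x, φ.eval j (Function.update v k x) := by
  simp [ex, eval]

@[simp] theorem eval_exNat : (φ.exNat k).eval j v ↔
    ∃ x, Mem x (j (stdLevel 0)) ∧ φ.eval j (Function.update v k x) := by
  simp [exNat, eval]

end

/-- The standard objects that occur as parameters in the translation of formulas. -/
inductive Par : Type
  | nat
  | card
  | rel (R : ℕ → ℕ → Prop)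

/-- The value of a parameter. -/
noncomputable def Par.val : Par → Std
  | nat => stdLevel 0
  | card => stdCard
  | rel R => stdRel R

/-- The formula in the language of set theory with the variable `inl k` universally quantified. -/
noncomputable def allForm {β : Type} (k : ℕ) (φ : memLang.Formula (ℕ ⊕ β)) :
    memLang.Formula (ℕ ⊕ β) :=
  (φ.relabel (Sum.elim (fun i : ℕ => if i = k then Sum.inr () else Sum.inl (Sum.inl i))
    fun b => Sum.inl (Sum.inr b))).iAlls Unit

theorem realize_allForm {X : Type*} [memLang.Structure X] {β : Type} {k : ℕ}
    {φ : memLang.Formula (ℕ ⊕ β)} {v : ℕ → X} {w : β → X} :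
    (allForm k φ).Realize (Sum.elim v w) ↔
      ∀ x, φ.Realize (Sum.elim (Function.update v k x) w) := by
  have key : ∀ f : Unit → X, (Sum.elim (Sum.elim v w) f) ∘
      (Sum.elim (fun i : ℕ => if i = k then Sum.inr () else Sum.inl (Sum.inl i))
        fun b => Sum.inl (Sum.inr b)) = Sum.elim (Function.update v k (f ())) w := by
    intro f
    funext i
    rcases i with i | b
    · by_cases h : i = k
      · subst h
        simp
      · simp [h]
    · simp
  simp only [allForm, FirstOrder.Language.Formula.realize_iAlls,
    FirstOrder.Language.Formula.realize_relabel]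
  constructor
  · intro h x
    have := h fun _ => x
    rwa [key] at this
  · intro h f
    rw [key]
    exact h _

/-- The translation of formulas into the language of set theory. -/
noncomputable def toFormula : Fm → memLang.Formula (ℕ ⊕ Par)
  | mem i k => memForm (.var (Sum.inl (Sum.inl i))) (.var (Sum.inl (Sum.inl k)))
  | eq i k => FirstOrder.Language.Term.equal (.var (Sum.inl i)) (.var (Sum.inl k))
  | rel R i k => relForm.relabel ![Sum.inl i, Sum.inl k, Sum.inr (Par.rel R)]
  | card i k => relForm.relabel ![Sum.inl i, Sum.inl k, Sum.inr Par.card]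
  | fls => ⊥
  | imp φ ψ => φ.toFormula.imp ψ.toFormula
  | all k φ => allForm k φ.toFormula
  | allNat k φ => allForm k
      (FirstOrder.Language.BoundedFormula.imp
        (memForm (.var (Sum.inl (Sum.inl k))) (.var (Sum.inl (Sum.inr Par.nat)))) φ.toFormula)

theorem realize_toFormula_std (φ : Fm) (v : ℕ → Std) :
    φ.toFormula.Realize (Sum.elim v Par.val) ↔ φ.evalStd v := by
  induction φ generalizing v with
  | mem i k => simp [toFormula, evalStd, FirstOrder.Language.Formula.Realize]
  | eq i k => simp [toFormula, evalStd]
  | rel R i k =>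
    rw [toFormula, FirstOrder.Language.Formula.realize_relabel, realize_relForm]
    exact relOn_stdRel
  | card i k =>
    rw [toFormula, FirstOrder.Language.Formula.realize_relabel, realize_relForm]
    exact relOn_stdCard
  | fls => exact Iff.rfl
  | imp φ ψ hφ hψ =>
    rw [toFormula, FirstOrder.Language.Formula.realize_imp, hφ, hψ, evalStd]
  | all k φ h => simp only [toFormula, realize_allForm, evalStd, h]
  | allNat k φ h =>
    simp only [toFormula, realize_allForm, evalStd]
    -- In `Std` the elements of `stdLevel 0` are exactly the `stdNat n`, so the bounded quantifier
    -- becomes one over `ℕ`.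
    have (x : Std) : FirstOrder.Language.Formula.Realize (FirstOrder.Language.BoundedFormula.imp
        (memForm (.var (Sum.inl (Sum.inl k))) (.var (Sum.inl (Sum.inr Par.nat)))) φ.toFormula)
        (Sum.elim (Function.update v k x) Par.val) ↔
        ((∃ n, x = stdNat n) → φ.evalStd (Function.update v k x)) := by
      rw [FirstOrder.Language.Formula.realize_imp, h, ← mem_stdLevel_zero]
      simp [FirstOrder.Language.Formula.Realize, Par.val]
    simp only [this, forall_exists_index]
    exact ⟨fun H n => H _ n rfl, fun H x n hn => hn ▸ H n⟩

theorem realize_toFormula {M : Type u} [memLang.Structure M] (j : Std ↪ₑ[memLang] M) (φ : Fm)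
    (v : ℕ → M) : φ.toFormula.Realize (Sum.elim v (j ∘ Par.val)) ↔ φ.eval j v := by
  induction φ generalizing v with
  | mem i k => simp [toFormula, eval, FirstOrder.Language.Formula.Realize]
  | eq i k => simp [toFormula, eval]
  | rel R i k =>
    rw [toFormula, FirstOrder.Language.Formula.realize_relabel, realize_relForm]
    exact Iff.rfl
  | card i k =>
    rw [toFormula, FirstOrder.Language.Formula.realize_relabel, realize_relForm]
    exact Iff.rfl
  | fls => exact Iff.rfl
  | imp φ ψ hφ hψ =>
    rw [toFormula, FirstOrder.Language.Formula.realize_imp, hφ, hψ, eval]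
  | all k φ h => simp only [toFormula, realize_allForm, eval, h]
  | allNat k φ h =>
    simp only [toFormula, realize_allForm, eval]
    refine forall_congr' fun x => ?_
    rw [FirstOrder.Language.Formula.realize_imp, h]
    simp [FirstOrder.Language.Formula.Realize, Par.val]

/-- The transfer principle. -/
theorem transfer {M : Type u} [memLang.Structure M] (j : Std ↪ₑ[memLang] M) (φ : Fm)
    (v : ℕ → Std) : φ.eval j (j ∘ v) ↔ φ.evalStd v := by
  rw [← realize_toFormula, ← realize_toFormula_std, ← j.map_formula, Sum.comp_elim]

end Fm

/-! ### The internal natural numbers -/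

section

variable {M : Type u} [memLang.Structure M] {j : Std ↪ₑ[memLang] M}

theorem mem_embed_stdLevel_of_mem {n : ℕ} {x y : M} (hx : Mem x y)
    (hy : Mem y (j (stdLevel n))) : Mem x (j (stdLevel n)) := by
  have h := (Fm.transfer j (.all 0 (.all 1 (.imp (.mem 0 1) (.imp (.mem 1 2) (.mem 0 2)))))
    (fun _ => stdLevel n)).2 (by
      simp only [Fm.evalStd]
      intro a b
      simpa [Function.update_apply] using mem_stdLevel_of_mem)
  simp only [Fm.eval] at h
  have := h x y
  simp at this
  exact this hx hy

theorem exists_NSU_of_mem {x : M} {y : NSU j} (h : Mem x y.1) : ∃ z : NSU j, z.1 = x := by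
  obtain ⟨n, hn⟩ := y.2
  exact ⟨⟨x, n, mem_embed_stdLevel_of_mem h hn⟩, rfl⟩

/-- Elements of an internal object are internal, so a description of its elements means the same in
`NSU j` as in `M`. This makes pairs, and then `StarRel` and `HasInternalCard`, accessible to
transfer. -/
theorem forall_mem_iff {a : NSU j} {P : M → Prop} (hP : ∀ w, P w → ∃ z : NSU j, z.1 = w) :
    (∀ w : NSU j, w.mem a ↔ P w.1) ↔ ∀ w : M, Mem w a.1 ↔ P w := by
  constructor
  · intro h w
    constructor
    · intro hw
      obtain ⟨z, rfl⟩ := exists_NSU_of_mem hw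
      exact (h z).1 hw
    · intro hw
      obtain ⟨z, rfl⟩ := hP w hw
      exact (h z).2 hw
  · intro h w
    exact h w.1

theorem isPair_iff {p x y : NSU j} : IsPair p x y ↔ PairOn p.1 x.1 y.1 := by
  have key (a b : NSU j) : ((∀ w : NSU j, w.mem a ↔ w = x) ∧ (∀ w : NSU j, w.mem b ↔ w = x ∨ w = y) ∧
      ∀ w : NSU j, w.mem p ↔ w = a ∨ w = b) ↔ ((∀ w, Mem w a.1 ↔ w = x.1) ∧
      (∀ w, Mem w b.1 ↔ w = x.1 ∨ w = y.1) ∧ ∀ w, Mem w p.1 ↔ w = a.1 ∨ w = b.1) := by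
    simp only [Subtype.ext_iff (a2 := x), Subtype.ext_iff (a2 := y), Subtype.ext_iff (a2 := a),
      Subtype.ext_iff (a2 := b)]
    rw [forall_mem_iff (P := fun w => w = x.1), forall_mem_iff (P := fun w => w = x.1 ∨ w = y.1),
      forall_mem_iff (P := fun w => w = a.1 ∨ w = b.1)]
    · rintro w (rfl | rfl) <;> exact ⟨_, rfl⟩
    · rintro w (rfl | rfl) <;> exact ⟨_, rfl⟩
    · rintro w rfl
      exact ⟨_, rfl⟩
  constructor
  · rintro ⟨a, b, h⟩
    exact ⟨a.1, b.1, (key a b).1 h⟩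
  · rintro ⟨a, b, h⟩
    obtain ⟨a, rfl⟩ := exists_NSU_of_mem ((h.2.2 a).2 (Or.inl rfl))
    obtain ⟨b, rfl⟩ := exists_NSU_of_mem ((h.2.2 b).2 (Or.inr rfl))
    exact ⟨a, b, (key a b).2 h⟩

theorem exists_isPair_mem_iff {x y r : NSU j} :
    (∃ p : NSU j, IsPair p x y ∧ p.mem r) ↔ RelOn x.1 y.1 r.1 := by
  constructor
  · rintro ⟨p, hp, h⟩
    exact ⟨p.1, isPair_iff.1 hp, h⟩
  · rintro ⟨p, hp, h⟩
    obtain ⟨p, rfl⟩ := exists_NSU_of_mem h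
    exact ⟨p, isPair_iff.2 hp, h⟩

theorem starRel_iff {R : ℕ → ℕ → Prop} {x y : NSU j} :
    StarRel R x y ↔ RelOn x.1 y.1 (j (stdRel R)) :=
  exists_isPair_mem_iff (r := star j (stdRel R))

theorem hasInternalCard_iff {A c : NSU j} :
    HasInternalCard A c ↔ RelOn A.1 c.1 (j stdCard) :=
  exists_isPair_mem_iff (r := star j stdCard)

end

/-! ### Codes of finite sets -/

/-- The finite set of natural numbers coded by a natural number. -/
def bits (n : ℕ) : Finset ℕ := Finset.equivBitIndices n

theorem exists_bits_eq (F : Finset ℕ) : ∃ n, bits n = F := Finset.equivBitIndices.surjective F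

/-- The relation "`a` belongs to the set coded by `b`". -/
def InBits (a b : ℕ) : Prop := a ∈ bits b

/-- The relation "the set coded by `a` has `b` elements". -/
def CardBits (a b : ℕ) : Prop := b = (bits a).card

/-- The relation "`a` belongs to `{1, …, b}`". -/
def InInterval (a b : ℕ) : Prop := 1 ≤ a ∧ a ≤ b

/-- The relation "`p / q ≤ c / h`". -/
def RatioLE (p q h c : ℕ) : Prop := p * h ≤ q * c

section

variable {M : Type u} [memLang.Structure M] {j : Std ↪ₑ[memLang] M}

variable (j) in
/-- The internal natural numbers. -/
abbrev HNat : Type u := (starNat j).El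

/-- The nonstandard version of a binary relation on `ℕ`, as a relation on `*ℕ`. -/
def HRel (R : ℕ → ℕ → Prop) (x y : HNat j) : Prop := StarRel R x.1 y.1

theorem relOn_hNat {R : ℕ → ℕ → Prop} {x y : HNat j} :
    RelOn x.1.1 y.1.1 (j (stdRel R)) ↔ HRel R x y := starRel_iff.symm

theorem forall_hNat {P : M → Prop} :
    (∀ x, Mem x (j (stdLevel 0)) → P x) ↔ ∀ x : HNat j, P x.1.1 :=
  ⟨fun h x => h _ x.2, fun h x hx => h ⟨⟨x, 0, hx⟩, hx⟩⟩

theorem exists_hNat {P : M → Prop} :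
    (∃ x, Mem x (j (stdLevel 0)) ∧ P x) ↔ ∃ x : HNat j, P x.1.1 :=
  ⟨fun ⟨x, hx, h⟩ => ⟨⟨⟨x, 0, hx⟩, hx⟩, h⟩, fun ⟨x, h⟩ => ⟨_, x.2, h⟩⟩

theorem hRel_of_imp {R S : ℕ → ℕ → Prop} (h : ∀ a b, R a b → S a b) {x y : HNat j}
    (hx : HRel R x y) : HRel S x y := by
  have := (Fm.transfer j (.allNat 0 (.allNat 1 (.imp (.rel R 0 1) (.rel S 0 1))))
    (fun _ => stdNat 0)).2 (by simpa [Fm.evalStd] using h)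
  simp [-Subtype.forall, Fm.eval, forall_hNat, relOn_hNat] at this
  exact this x y hx

theorem hRel_not {R : ℕ → ℕ → Prop} {x y : HNat j} :
    HRel (fun a b => ¬ R a b) x y ↔ ¬ HRel R x y := by
  have := (Fm.transfer j (.allNat 0 (.allNat 1 (.iff (.rel (fun a b => ¬ R a b) 0 1)
    (.neg (.rel R 0 1))))) (fun _ => stdNat 0)).2 (by simp [Fm.evalStd])
  simp [-Subtype.forall, Fm.eval, forall_hNat, relOn_hNat] at this
  exact this x y

theorem hRel_and {R S : ℕ → ℕ → Prop} {x y : HNat j} :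
    HRel (fun a b => R a b ∧ S a b) x y ↔ HRel R x y ∧ HRel S x y := by
  have := (Fm.transfer j (.allNat 0 (.allNat 1 (.iff (.rel (fun a b => R a b ∧ S a b) 0 1)
    (.and (.rel R 0 1) (.rel S 0 1))))) (fun _ => stdNat 0)).2 (by simp [Fm.evalStd])
  simp [-Subtype.forall, Fm.eval, forall_hNat, relOn_hNat] at this
  exact this x y

theorem hRel_of_forall {R : ℕ → ℕ → Prop} (h : ∀ a b, R a b) (x y : HNat j) : HRel R x y := by
  by_contra hR
  -- The failure of `*R` gives the star of `¬ R`, which implies `*R` because `R` always holds.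
  exact hRel_not.2 hR |> hRel_of_imp (S := R) (fun a b _ => h a b) |> hR

/-- The set `{1, …, h}` is coded. -/
theorem exists_code_interval (h : HNat j) :
    ∃ y : HNat j, ∀ x : HNat j, HRel InBits x y ↔ HRel InInterval x h := by
  have := (Fm.transfer j (.allNat 0 (.exNat 1 (.allNat 2 (.iff (.rel InBits 2 1)
    (.rel InInterval 2 0))))) (fun _ => stdNat 0)).2 (by
      simp only [Fm.evalStd, Fm.evalStd_exNat, Fm.evalStd_iff]
      intro n
      obtain ⟨y, hy⟩ := exists_bits_eq (Finset.Icc 1 n)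
      refine ⟨y, fun x => ?_⟩
      simp [InBits, hy, InInterval])
  simp [-Subtype.forall, -Subtype.exists, Fm.eval, forall_hNat, exists_hNat, relOn_hNat] at this
  exact this h

/-- Codes are closed under separation by a standard relation. -/
theorem exists_code_separation (R : ℕ → ℕ → Prop) (y z : HNat j) :
    ∃ w : HNat j, ∀ x : HNat j, HRel InBits x w ↔ HRel InBits x y ∧ HRel R x z := by
  have := (Fm.transfer j (.allNat 0 (.allNat 1 (.exNat 2 (.allNat 3 (.iff (.rel InBits 3 2)
    (.and (.rel InBits 3 0) (.rel R 3 1))))))) (fun _ => stdNat 0)).2 (by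
      classical
      simp only [Fm.evalStd, Fm.evalStd_exNat, Fm.evalStd_iff, Fm.evalStd_and]
      intro a b
      obtain ⟨y, hy⟩ := exists_bits_eq ((bits a).filter fun x => R x b)
      refine ⟨y, fun x => ?_⟩
      simp [InBits, hy])
  simp [-Subtype.forall, -Subtype.exists, Fm.eval, forall_hNat, exists_hNat, relOn_hNat] at this
  exact this y z

theorem exists_hRel_cardBits (y : HNat j) : ∃ c : HNat j, HRel CardBits y c := by
  have := (Fm.transfer j (.allNat 0 (.exNat 1 (.rel CardBits 0 1)))
    (fun _ => stdNat 0)).2 (by simp [Fm.evalStd, CardBits])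
  simp [-Subtype.forall, -Subtype.exists, Fm.eval, forall_hNat, exists_hNat, relOn_hNat] at this
  exact this y

/-- Finite additivity of counting, in the form needed for rational lower bounds: the new fraction is
`p₁ / q₁ + p₂ / q₂`. -/
theorem RatioLE.add_of_bits {p₁ q₁ p₂ q₂ : ℕ} {y z y₁ y₂ h c c₁ c₂ : ℕ}
    (h₁ : ∀ x, InBits x y₁ ↔ InBits x y ∧ InBits x z)
    (h₂ : ∀ x, InBits x y₂ ↔ InBits x y ∧ ¬ InBits x z)
    (hc : CardBits y c) (hc₁ : CardBits y₁ c₁) (hc₂ : CardBits y₂ c₂)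
    (hr₁ : RatioLE p₁ q₁ h c₁) (hr₂ : RatioLE p₂ q₂ h c₂) :
    RatioLE (p₁ * q₂ + p₂ * q₁) (q₁ * q₂) h c := by
  have e₁ : bits y₁ = bits y ∩ bits z := by
    ext x
    simpa [InBits] using h₁ x
  have e₂ : bits y₂ = bits y \ bits z := by
    ext x
    simpa [InBits] using h₂ x
  have hsum : c = c₁ + c₂ := by
    rw [CardBits] at hc hc₁ hc₂
    rw [hc, hc₁, hc₂, e₁, e₂, Finset.card_inter_add_card_sdiff]
  simp only [RatioLE] at *
  rw [hsum]
  calc (p₁ * q₂ + p₂ * q₁) * h = q₂ * (p₁ * h) + q₁ * (p₂ * h) := by ring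
    _ ≤ q₂ * (q₁ * c₁) + q₁ * (q₂ * c₂) := by gcongr
    _ = q₁ * q₂ * (c₁ + c₂) := by ring

set_option maxHeartbeats 1000000 in
theorem hRel_ratioLE_add {p₁ q₁ p₂ q₂ : ℕ} {y z y₁ y₂ h c c₁ c₂ : HNat j}
    (h₁ : ∀ x, HRel InBits x y₁ ↔ HRel InBits x y ∧ HRel InBits x z)
    (h₂ : ∀ x, HRel InBits x y₂ ↔ HRel InBits x y ∧ ¬ HRel InBits x z)
    (hc : HRel CardBits y c) (hc₁ : HRel CardBits y₁ c₁) (hc₂ : HRel CardBits y₂ c₂)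
    (hr₁ : HRel (RatioLE p₁ q₁) h c₁) (hr₂ : HRel (RatioLE p₂ q₂) h c₂) :
    HRel (RatioLE (p₁ * q₂ + p₂ * q₁) (q₁ * q₂)) h c := by
  have := (Fm.transfer j (.allNat 0 (.allNat 1 (.allNat 2 (.allNat 3 (.allNat 4 (.allNat 5
    (.allNat 6 (.allNat 7 (
      .imp (.allNat 8 (.iff (.rel InBits 8 2) (.and (.rel InBits 8 0) (.rel InBits 8 1))))
      (.imp (.allNat 8 (.iff (.rel InBits 8 3) (.and (.rel InBits 8 0) (.neg (.rel InBits 8 1)))))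
      (.imp (.rel CardBits 0 5) (.imp (.rel CardBits 2 6) (.imp (.rel CardBits 3 7)
      (.imp (.rel (RatioLE p₁ q₁) 4 6) (.imp (.rel (RatioLE p₂ q₂) 4 7)
      (.rel (RatioLE (p₁ * q₂ + p₂ * q₁) (q₁ * q₂)) 4 5))))))))))))))))
      (fun _ => stdNat 0)).2 (by
      simp [Fm.evalStd, -not_and, -and_imp]
      exact fun _ _ _ _ _ _ _ _ => RatioLE.add_of_bits)
  simp [-Subtype.forall, Fm.eval, forall_hNat, relOn_hNat] at this
  exact this y z y₁ y₂ h c c₁ c₂ (fun x => by simpa using h₁ x) (fun x => by simpa using h₂ x)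
    hc hc₁ hc₂ hr₁ hr₂

theorem hRel_le_of_cardBits {y h c : HNat j}
    (hy : ∀ x, HRel InBits x y → HRel InInterval x h) (hc : HRel CardBits y c) :
    HRel (fun a b => b ≤ a) h c := by
  have := (Fm.transfer j (.allNat 0 (.allNat 1 (.allNat 2
      (.imp (.allNat 3 (.imp (.rel InBits 3 0) (.rel InInterval 3 1)))
      (.imp (.rel CardBits 0 2) (.rel (fun a b => b ≤ a) 1 2))))))
      (fun _ => stdNat 0)).2 (by
      simp [Fm.evalStd]
      intro y h c hy hc
      have : bits y ⊆ Finset.Icc 1 h := fun x hx => Finset.mem_Icc.2 (hy x hx)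
      have := Finset.card_le_card this
      rw [CardBits] at hc
      simpa [hc] using this)
  simp [-Subtype.forall, Fm.eval, forall_hNat, relOn_hNat] at this
  exact this y h c hy hc

/-- The first `n` binary digits of `a` form the characteristic function of `s`. -/
def InCylinder (n : ℕ) (s : Finset ℕ) (a : ℕ) : Prop := ∀ i < n, a.testBit i = true ↔ i ∈ s

/-- Numbers with the same first `n` digits are determined by their quotient by `2 ^ n`, which is at
most `h / 2 ^ n`. The extra `2 ^ n` allows for an incomplete last block. -/
theorem card_mul_two_pow_le {n h : ℕ} {s F : Finset ℕ} (hF : ∀ x ∈ F, InInterval x h)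
    (hs : ∀ x ∈ F, InCylinder n s x) : F.card * 2 ^ n ≤ h + 2 ^ n := by
  have h1 : F.card ≤ (Finset.range (h / 2 ^ n + 1)).card := by
    refine Finset.card_le_card_of_injOn (fun x => x / 2 ^ n) (fun x hx => ?_) fun x hx y hy e => ?_
    · simp only [Finset.coe_range, Set.mem_Iio]
      exact Nat.lt_succ_of_le (Nat.div_le_div_right (hF x hx).2)
    · refine Nat.eq_of_testBit_eq fun i => ?_
      rcases lt_or_ge i n with hi | hi
      · exact Bool.eq_iff_iff.2 ((hs x hx i hi).trans (hs y hy i hi).symm)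
      · have := congrArg (fun z => z.testBit (i - n)) e
        simpa [Nat.testBit_div_two_pow, Nat.sub_add_cancel hi] using this
  rw [Finset.card_range] at h1
  calc F.card * 2 ^ n ≤ (h / 2 ^ n + 1) * 2 ^ n := Nat.mul_le_mul_right _ h1
    _ = h / 2 ^ n * 2 ^ n + 2 ^ n := by ring
    _ ≤ h + 2 ^ n := Nat.add_le_add_right (Nat.div_mul_le_self h _) _

theorem hRel_card_cylinder {n : ℕ} {s : Finset ℕ} {y h c : HNat j}
    (hy : ∀ x, HRel InBits x y → HRel InInterval x h)
    (hs : ∀ x, HRel InBits x y → HRel (fun a _ => InCylinder n s a) x x)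
    (hc : HRel CardBits y c) : HRel (fun a b => b * 2 ^ n ≤ a + 2 ^ n) h c := by
  have := (Fm.transfer j (.allNat 0 (.allNat 1 (.allNat 2
      (.imp (.allNat 3 (.imp (.rel InBits 3 0) (.rel InInterval 3 1)))
      (.imp (.allNat 3 (.imp (.rel InBits 3 0) (.rel (fun a _ => InCylinder n s a) 3 3)))
      (.imp (.rel CardBits 0 2) (.rel (fun a b => b * 2 ^ n ≤ a + 2 ^ n) 1 2)))))))
      (fun _ => stdNat 0)).2 (by
      simp [Fm.evalStd]
      intro y h c hy hs hc
      rw [hc]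
      exact card_mul_two_pow_le hy hs)
  simp [-Subtype.forall, Fm.eval, forall_hNat, relOn_hNat] at this
  exact this y h c hy hs hc

/-! ### Internal sets versus their codes -/

theorem mem_starNat_of_starRel {R : ℕ → ℕ → Prop} {x y : NSU j} (h : StarRel R x y) :
    x.mem (starNat j) ∧ y.mem (starNat j) := by
  have := (Fm.transfer j (.all 0 (.all 1 (.imp (.rel R 0 1) (.and (.mem 0 2) (.mem 1 2)))))
      (fun _ => stdLevel 0)).2 (by
      simp [Fm.evalStd]
      rintro _ _ a b - rfl rfl
      exact ⟨mem_stdLevel_zero.2 ⟨a, rfl⟩, mem_stdLevel_zero.2 ⟨b, rfl⟩⟩)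
  simp [Fm.eval] at this
  exact this x.1 y.1 (starRel_iff.1 h)

/-- Every internal set with an internal cardinality is coded. -/
theorem exists_code_of_hasInternalCard {A c : NSU j} (h : HasInternalCard A c) :
    ∃ y c' : HNat j, c'.1 = c ∧ (∀ x : NSU j, x.mem A ↔ StarRel InBits x y.1) ∧
      HRel CardBits y c' := by
  have := (Fm.transfer j (.all 0 (.all 1 (.imp (.card 0 1) (.exNat 2 (.and
      (.all 3 (.iff (.mem 3 0) (.rel InBits 3 2))) (.rel CardBits 2 1))))))
      (fun _ => stdNat 0)).2 (by
      simp [Fm.evalStd]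
      rintro _ _ F rfl rfl
      obtain ⟨y, rfl⟩ := exists_bits_eq F
      refine ⟨y, fun x => mem_stdFinset.trans ?_, _, rfl, rfl⟩
      simp [InBits])
  simp [-Subtype.forall, -Subtype.exists, Fm.eval, exists_hNat] at this
  obtain ⟨y, h₁, h₂⟩ := this A.1 c.1 (hasInternalCard_iff.1 h)
  have h₂' : StarRel CardBits y.1 c := starRel_iff.2 h₂
  exact ⟨y, ⟨c, (mem_starNat_of_starRel h₂').2⟩, rfl,
    fun x => (h₁ x.1).trans starRel_iff.symm, h₂'⟩

/-- Every code is the code of an internal set. -/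
theorem exists_hasInternalCard_of_code {y c : HNat j} (h : HRel CardBits y c) :
    ∃ A : NSU j, HasInternalCard A c.1 ∧ ∀ x : NSU j, x.mem A ↔ StarRel InBits x y.1 := by
  have := (Fm.transfer j (.allNat 0 (.allNat 1 (.imp (.rel CardBits 0 1) (.ex 2 (.and
      (.card 2 1) (.all 3 (.iff (.mem 3 2) (.rel InBits 3 0))))))))
      (fun _ => stdNat 0)).2 (by
      simp [Fm.evalStd]
      rintro y c rfl
      refine ⟨bits y, rfl, fun x => mem_stdFinset.trans ?_⟩
      simp [InBits])
  simp [-Subtype.forall, -Subtype.exists, Fm.eval, forall_hNat] at this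
  obtain ⟨A, h₁, h₂⟩ := this y c (relOn_hNat.2 h)
  obtain ⟨p, ⟨a, b, ha, hb, hp⟩, hm⟩ := id h₁
  obtain ⟨p, rfl⟩ := exists_NSU_of_mem (y := star j stdCard) hm
  obtain ⟨a, rfl⟩ := exists_NSU_of_mem ((hp a).2 (Or.inl rfl))
  obtain ⟨A, rfl⟩ := exists_NSU_of_mem ((ha A).2 rfl)
  exact ⟨A, hasInternalCard_iff.2 h₁, fun x => (h₂ x.1).trans starRel_iff.symm⟩

theorem IsHyperfinite.le {H : HNat j} (hH : IsHyperfinite H.1) (k : ℕ) :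
    HRel (fun a _ => k ≤ a) H H := by
  induction k with
  | zero => exact hRel_of_forall (fun _ _ => Nat.zero_le _) _ _
  | succ k ih =>
    -- The free variable `1` carries the standard number `k`, through the constant assignment
    -- `stdNat k`.
    have := (Fm.transfer j (.allNat 0 (.imp (.rel (fun a _ => k ≤ a) 0 0)
      (.imp (.neg (.eq 0 1)) (.rel (fun a _ => k + 1 ≤ a) 0 0)))) (fun _ => stdNat k)).2 (by
        simp [Fm.evalStd]
        intro n h₁ h₂
        omega)
    simp [-Subtype.forall, Fm.eval, forall_hNat, relOn_hNat] at this
    exact this H ih fun h => hH.2 k (Subtype.ext h)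

end

/-! ### Measures on the Cantor space -/

/-- The basic clopen set of the Cantor space determined by the first `n` values of the
characteristic function of `s`. -/
def cyl (n : ℕ) (s : Finset ℕ) : Set (ℕ → Bool) :=
  PiNat.cylinder (fun i => decide (i ∈ s)) n

theorem mem_cyl {n : ℕ} {s : Finset ℕ} {f : ℕ → Bool} :
    f ∈ cyl n s ↔ ∀ i < n, f i = true ↔ i ∈ s := by
  refine forall₂_congr fun i _ => ?_
  by_cases h : i ∈ s <;> simp [h]

theorem isOpen_cyl (n : ℕ) (s : Finset ℕ) : IsOpen (cyl n s) :=
  PiNat.isOpen_cylinder _ _ _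

theorem exists_cyl_eq (f : ℕ → Bool) (n : ℕ) :
    ∃ s ⊆ Finset.range n, PiNat.cylinder f n = cyl n s := by
  refine ⟨(Finset.range n).filter fun i => f i = true, Finset.filter_subset _ _, ?_⟩
  refine PiNat.mem_cylinder_iff_eq.1 fun i hi => ?_
  simp [hi]

theorem coinMeasure_cyl (n : ℕ) (s : Finset ℕ) : coinMeasure (cyl n s) = 2⁻¹ ^ n := by
  have : cyl n s = Set.pi (Finset.range n) fun i => {decide (i ∈ s)} := by
    ext f
    simp [cyl, PiNat.cylinder, Set.mem_pi]
  rw [this, coinMeasure, Measure.infinitePi_pi _ fun _ _ => measurableSet_singleton _]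
  simp [Classical.em]

theorem exists_cylinder_subset {U : Set (ℕ → Bool)} (hU : IsOpen U) {f : ℕ → Bool} (hf : f ∈ U) :
    ∃ n, PiNat.cylinder f n ⊆ U := by
  obtain ⟨I, u, hu, hI⟩ := isOpen_pi_iff.1 hU f hf
  refine ⟨I.sup id + 1, fun g hg => hI fun i hi => ?_⟩
  rw [hg i (Nat.lt_succ_of_le (Finset.le_sup (f := id) hi))]
  exact (hu i hi).2

/-- An open set is the increasing union of the sets `V n` of points whose cylinder of length `n` it
contains, and each `V n` is a finite disjoint union of such cylinders. -/
theorem measure_le_mul_of_isOpen {μ ν : Measure (ℕ → Bool)} {c : ENNReal}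
    (h : ∀ n s, ν (cyl n s) ≤ c * μ (cyl n s)) {U : Set (ℕ → Bool)} (hU : IsOpen U) :
    ν U ≤ c * μ U := by
  classical
  let V : ℕ → Set (ℕ → Bool) := fun n => {f | PiNat.cylinder f n ⊆ U}
  have hVU : U = ⋃ n, V n := by
    ext f
    simp only [Set.mem_iUnion]
    exact ⟨fun hf => exists_cylinder_subset hU hf,
      fun ⟨n, hn⟩ => hn (PiNat.self_mem_cylinder f n)⟩
  have hmono : Monotone V := fun m n hmn f hf => (PiNat.cylinder_anti f hmn).trans hf
  have hV (n : ℕ) : ν (V n) ≤ c * μ U := by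
    let T := (Finset.range n).powerset.filter fun s => cyl n s ⊆ U
    have hVT : V n = ⋃ s ∈ T, cyl n s := by
      ext f
      simp only [Set.mem_iUnion, exists_prop]
      constructor
      · intro hf
        obtain ⟨s, hs, he⟩ := exists_cyl_eq f n
        exact ⟨s, Finset.mem_filter.2 ⟨Finset.mem_powerset.2 hs, he ▸ hf⟩, he ▸ PiNat.self_mem_cylinder f n⟩
      · rintro ⟨s, hs, hf⟩
        have : PiNat.cylinder f n = cyl n s := PiNat.mem_cylinder_iff_eq.1 hf
        simpa [V, this] using (Finset.mem_filter.1 hs).2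
    have hdisj : (T : Set (Finset ℕ)).PairwiseDisjoint (cyl n) := by
      intro s hs t ht hst
      refine Set.disjoint_left.2 fun f hf hf' => hst ?_
      rw [mem_cyl] at hf hf'
      have hs' := Finset.mem_powerset.1 (Finset.mem_filter.1 hs).1
      have ht' := Finset.mem_powerset.1 (Finset.mem_filter.1 ht).1
      ext i
      constructor
      · intro hi
        have := Finset.mem_range.1 (hs' hi)
        exact (hf' i this).1 ((hf i this).2 hi)
      · intro hi
        have := Finset.mem_range.1 (ht' hi)
        exact (hf i this).1 ((hf' i this).2 hi)
    calc ν (V n) ≤ ∑ s ∈ T, ν (cyl n s) := hVT ▸ measure_biUnion_finset_le T _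
      _ ≤ ∑ s ∈ T, c * μ (cyl n s) := Finset.sum_le_sum fun s _ => h n s
      _ = c * μ (⋃ s ∈ T, cyl n s) := by
        rw [← Finset.mul_sum,
          measure_biUnion_finset hdisj fun s _ => (isOpen_cyl n s).measurableSet]
      _ ≤ c * μ U := by
        gcongr
        exact Set.iUnion₂_subset fun s hs => (Finset.mem_filter.1 hs).2
  conv_lhs => rw [hVU]
  rw [hmono.measure_iUnion]
  exact iSup_le hV

theorem absolutelyContinuous_of_cyl {μ ν : Measure (ℕ → Bool)} [IsFiniteMeasure μ] {c : ENNReal}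
    (hc : c ≠ ⊤) (h : ∀ n s, ν (cyl n s) ≤ c * μ (cyl n s)) : ν ≪ μ := by
  intro Z hZ
  refine le_antisymm (ENNReal.le_of_forall_pos_le_add fun ε hε _ => ?_) zero_le
  -- Dividing by `c + 1` instead of `c` covers the case `c = 0`.
  have hε' : (0 : ENNReal) < ε / (c + 1) :=
    ENNReal.div_pos (by simpa using hε.ne') (by simp [hc])
  obtain ⟨U, hZU, hU, hμ⟩ := Z.exists_isOpen_lt_of_lt (μ := μ) _ (hZ ▸ hε')
  calc ν Z ≤ ν U := measure_mono hZU
    _ ≤ c * μ U := measure_le_mul_of_isOpen h hU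
    _ ≤ (c + 1) * (ε / (c + 1)) := by gcongr; exact le_self_add
    _ = 0 + ε := by rw [ENNReal.mul_div_cancel (by simp) (by simp [hc]), zero_add]

/-- A finite measure that vanishes on a set is carried, up to a small error, by closed sets
disjoint from it. -/
theorem exists_isClosed_disjoint {ν : Measure (ℕ → Bool)} [IsFiniteMeasure ν]
    {Z : Set (ℕ → Bool)} (hZ : ν Z = 0) {ε : ENNReal} (hε : ε ≠ 0) :
    ∃ K, IsClosed K ∧ Disjoint K Z ∧ ν Kᶜ ≤ ε := by
  obtain ⟨U, hZU, hU, hν⟩ := Z.exists_isOpen_lt_of_lt (μ := ν) ε (hZ ▸ hε.bot_lt)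
  exact ⟨Uᶜ, hU.isClosed_compl, Set.disjoint_left.2 fun x hx hxZ => hx (hZU hxZ),
    by simpa using hν.le⟩

section

variable {M : Type u} [memLang.Structure M] {j : Std ↪ₑ[memLang] M}

/-- If `P` failed, `R` would be empty on `ℕ`, and so would its nonstandard version. This turns
nonstandard inequalities into inequalities between standard reals. -/
theorem of_hRel {R : ℕ → ℕ → Prop} {P : Prop} (hP : ∀ a b, R a b → P) {x y : HNat j}
    (h : HRel R x y) : P := by
  by_contra hn
  exact hRel_not.1 (hRel_of_forall (fun a b hab => hn (hP a b hab)) x y) h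

theorem hRel_fst {P : ℕ → Prop} {x y z : HNat j} (h : HRel (fun a _ => P a) x y) :
    HRel (fun a _ => P a) x z := by
  have := (Fm.transfer j (.allNat 0 (.allNat 1 (.allNat 2 (.imp (.rel (fun a _ => P a) 0 1)
    (.rel (fun a _ => P a) 0 2))))) (fun _ => stdNat 0)).2 (by simp [Fm.evalStd])
  simp [-Subtype.forall, Fm.eval, forall_hNat, relOn_hNat] at this
  exact this x y z h

/-! ### Internal subsets of the hyperfinite space -/

/-- A point of the hyperfinite space as an internal natural number. -/
def toHNat {h : HNat j} (x : Omega h.1) : HNat j := ⟨x.1, (mem_starNat_of_starRel x.2).1⟩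

theorem toHNat_mem {h : HNat j} (x : Omega h.1) : HRel InInterval (toHNat x) h := x.2

/-- The set of points of the hyperfinite space that belong to the set coded by `y`. -/
def codeSet (h y : HNat j) : Set (Omega h.1) := {x | HRel InBits (toHNat x) y}

/-- `y` codes an internal subset of `{1, …, h}`. -/
def IsCode (h y : HNat j) : Prop := ∀ x, HRel InBits x y → HRel InInterval x h

theorem internalProb_codeSet_le {h y c : HNat j} (hy : IsCode h y) (hc : HRel CardBits y c) :
    internalProb h.1 (codeSet h y) ≤ ENNReal.ofReal (stRatio c.1 h.1) := by
  obtain ⟨A, hA, hAy⟩ := exists_hasInternalCard_of_code hc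
  refine iInf_le_of_le A (iInf_le_of_le c.1 (iInf_le_of_le ⟨⟨fun x hx => ?_, fun x => ?_⟩, hA⟩ le_rfl))
  · have := (hAy x).1 hx
    exact hy ⟨x, (mem_starNat_of_starRel this).1⟩ this
  · exact (hAy x.1).symm

/-- Since `internalProb` is infinite off the internal sets, lower bounds need checking only against
codes. -/
theorem le_internalProb {h : HNat j} {S : Set (Omega h.1)} {b : ENNReal}
    (H : ∀ y c : HNat j, IsCode h y → S = codeSet h y → HRel CardBits y c →
      b ≤ ENNReal.ofReal (stRatio c.1 h.1)) : b ≤ internalProb h.1 S := by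
  refine le_iInf fun A => le_iInf fun c => le_iInf fun ⟨⟨hA, hS⟩, hc⟩ => ?_
  obtain ⟨y, c, rfl, hAy, hyc⟩ := exists_code_of_hasInternalCard hc
  refine H y c (fun x hx => hA x.1 ((hAy x.1).2 hx)) ?_ hyc
  ext x
  exact (hS x).trans (hAy x.1)

/-! ### Standard parts of counting ratios -/

theorem stRatio_le {R : ℕ → ℕ → Prop} {h c : HNat j} {t : ℝ} (ht : 0 ≤ t) (hR : HRel R h c)
    (H : ∀ p q a b : ℕ, 0 < q → R a b → RatioLE p q a b → (p / q : ℝ) ≤ t) :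
    stRatio c.1 h.1 ≤ t := by
  refine Real.sSup_le ?_ ht
  rintro _ ⟨p, q, hq, rfl, hpq⟩
  exact of_hRel (fun a b hab => H p q a b hq hab.1 hab.2) (hRel_and.2 ⟨hR, hpq⟩)

theorem bddAbove_ratio {R : ℕ → ℕ → Prop} {h c : HNat j} {t : ℝ} (hR : HRel R h c)
    (H : ∀ p q a b : ℕ, 0 < q → R a b → RatioLE p q a b → (p / q : ℝ) ≤ t) :
    BddAbove {r : ℝ | ∃ p q : ℕ, 0 < q ∧ r = p / q ∧
      StarRel (fun h a => p * h ≤ q * a) h.1 c.1} := by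
  refine ⟨t, ?_⟩
  rintro _ ⟨p, q, hq, rfl, hpq⟩
  exact of_hRel (fun a b hab => H p q a b hq hab.1 hab.2) (hRel_and.2 ⟨hR, hpq⟩)

theorem stRatio_nonneg (c h : NSU j) : 0 ≤ stRatio c h := by
  refine Real.sSup_nonneg ?_
  rintro _ ⟨p, q, hq, rfl, -⟩
  positivity

theorem hRel_card_bound {h y c : HNat j} (hh : IsHyperfinite h.1) (hy : IsCode h y)
    (hc : HRel CardBits y c) : HRel (fun a b => 1 ≤ a ∧ b ≤ a) h c :=
  hRel_and.2 ⟨hRel_fst (hh.le 1), hRel_le_of_cardBits hy hc⟩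

theorem ratio_le_one {p q a b : ℕ} (hq : 0 < q) (hab : 1 ≤ a ∧ b ≤ a) (h : RatioLE p q a b) :
    (p / q : ℝ) ≤ 1 := by
  have h1 : p * a ≤ q * a := h.trans (Nat.mul_le_mul_left q hab.2)
  have h2 : p ≤ q := Nat.le_of_mul_le_mul_right h1 hab.1
  rw [div_le_one (by exact_mod_cast hq)]
  exact_mod_cast h2

/-- Superadditivity is the direction that the Carathéodory criterion asks for; it follows by adding
rational lower bounds. -/
theorem stRatio_add_le {h y z y₁ y₂ c c₁ c₂ : HNat j} (hh : IsHyperfinite h.1) (hy : IsCode h y)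
    (h₁ : ∀ x, HRel InBits x y₁ ↔ HRel InBits x y ∧ HRel InBits x z)
    (h₂ : ∀ x, HRel InBits x y₂ ↔ HRel InBits x y ∧ ¬ HRel InBits x z)
    (hc : HRel CardBits y c) (hc₁ : HRel CardBits y₁ c₁) (hc₂ : HRel CardBits y₂ c₂) :
    stRatio c₁.1 h.1 + stRatio c₂.1 h.1 ≤ stRatio c.1 h.1 := by
  have hne (d : HNat j) : {r : ℝ | ∃ p q : ℕ, 0 < q ∧ r = p / q ∧
      StarRel (fun h a => p * h ≤ q * a) h.1 d.1}.Nonempty :=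
    ⟨0, 0, 1, one_pos, by simp, hRel_of_forall (R := fun a b => 0 * a ≤ 1 * b)
      (fun a b => by simp) h d⟩
  rw [← le_sub_iff_add_le]
  refine csSup_le (hne c₁) ?_
  rintro _ ⟨p₁, q₁, hq₁, rfl, hr₁⟩
  rw [le_sub_comm]
  refine csSup_le (hne c₂) ?_
  rintro _ ⟨p₂, q₂, hq₂, rfl, hr₂⟩
  rw [le_sub_iff_add_le]
  refine le_csSup (bddAbove_ratio (hRel_card_bound hh hy hc)
    fun p q a b hq hab h => ratio_le_one hq hab h)
    ⟨p₁ * q₂ + p₂ * q₁, q₁ * q₂, Nat.mul_pos hq₁ hq₂, ?_,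
      hRel_ratioLE_add h₁ h₂ hc hc₁ hc₂ hr₁ hr₂⟩
  have : (q₁ : ℝ) ≠ 0 := by positivity
  have : (q₂ : ℝ) ≠ 0 := by positivity
  push_cast
  field_simp
  ring

/-! ### Loeb measure of coded sets -/

theorem measurableSet_codeSet {h : HNat j} (hh : IsHyperfinite h.1) (z : HNat j) :
    MeasurableSet (codeSet h z) := by
  -- The criterion has to be tested only on internal `t`, and these are split by `codeSet h z` into
  -- two internal pieces.
  refine OuterMeasure.boundedBy_caratheodory fun t => le_internalProb fun y c hy ht hc => ?_
  obtain ⟨y₁, h₁⟩ := exists_code_separation InBits y z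
  obtain ⟨y₂, h₂⟩ := exists_code_separation (fun a b => ¬ InBits a b) y z
  simp only [hRel_not] at h₂
  obtain ⟨c₁, hc₁⟩ := exists_hRel_cardBits y₁
  obtain ⟨c₂, hc₂⟩ := exists_hRel_cardBits y₂
  have e₁ : t ∩ codeSet h z = codeSet h y₁ := by
    rw [ht]
    ext x
    exact (h₁ _).symm
  have e₂ : t \ codeSet h z = codeSet h y₂ := by
    rw [ht]
    ext x
    exact (h₂ _).symm
  rw [e₁, e₂]
  refine (add_le_add (internalProb_codeSet_le (fun x hx => hy x ((h₁ x).1 hx).1) hc₁)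
    (internalProb_codeSet_le (fun x hx => hy x ((h₂ x).1 hx).1) hc₂)).trans ?_
  rw [← ENNReal.ofReal_add (stRatio_nonneg _ _) (stRatio_nonneg _ _)]
  exact ENNReal.ofReal_le_ofReal (stRatio_add_le hh hy h₁ h₂ hc hc₁ hc₂)

theorem loebMeasure_apply {H : NSU j} {S : Set (Omega H)} (hS : MeasurableSet S) :
    loebMeasure H S = loebOuter H S :=
  toMeasure_apply _ _ hS

theorem loebMeasure_codeSet_le {h y c : HNat j} (hh : IsHyperfinite h.1) (hy : IsCode h y)
    (hc : HRel CardBits y c) :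
    loebMeasure h.1 (codeSet h y) ≤ ENNReal.ofReal (stRatio c.1 h.1) :=
  (loebMeasure_apply (measurableSet_codeSet hh y)).trans_le
    ((OuterMeasure.boundedBy_le _).trans (internalProb_codeSet_le hy hc))

theorem isFiniteMeasure_loebMeasure {h : HNat j} (hh : IsHyperfinite h.1) :
    IsFiniteMeasure (loebMeasure h.1) := by
  obtain ⟨y, hy⟩ := exists_code_interval h
  obtain ⟨c, hc⟩ := exists_hRel_cardBits y
  have : codeSet h y = Set.univ := Set.eq_univ_of_forall fun x => (hy _).2 x.2
  refine ⟨?_⟩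
  rw [← this]
  exact (loebMeasure_codeSet_le hh (fun x => (hy x).1) hc).trans_lt ENNReal.ofReal_lt_top

/-- A measurable set is covered up to `ε` by countably many coded sets. -/
theorem exists_codeSet_cover {h : HNat j} (hh : IsHyperfinite h.1) {S : Set (Omega h.1)}
    (hS : MeasurableSet S) {ε : ENNReal} (hε : ε ≠ 0) :
    ∃ y : ℕ → HNat j, S ⊆ ⋃ n, codeSet h (y n) ∧
      loebMeasure h.1 (⋃ n, codeSet h (y n)) ≤ loebMeasure h.1 S + ε := by
  have := isFiniteMeasure_loebMeasure hh
  have hlt : loebOuter h.1 S < loebMeasure h.1 S + ε := by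
    rw [← loebMeasure_apply hS]
    exact ENNReal.lt_add_right (measure_ne_top _ _) hε
  rw [loebOuter, OuterMeasure.boundedBy_apply] at hlt
  simp only [iInf_lt_iff] at hlt
  obtain ⟨t, hSt, ht⟩ := hlt
  have key (n : ℕ) : ∃ y : HNat j, t n ⊆ codeSet h y ∧
      loebMeasure h.1 (codeSet h y) ≤ ⨆ _ : (t n).Nonempty, internalProb h.1 (t n) := by
    rcases (t n).eq_empty_or_nonempty with he | hne
    · obtain ⟨y, hy⟩ := exists_code_separation (fun _ _ => False) h h
      have : codeSet h y = ∅ := by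
        ext x
        refine iff_of_false (fun hx => ?_) (Set.notMem_empty x)
        exact of_hRel (fun _ _ h => h) ((hy _).1 hx).2
      exact ⟨y, by simp [he], by simp [this]⟩
    · simp only [hne, iSup_pos]
      have hfin : internalProb h.1 (t n) < ⊤ := by
        refine lt_of_le_of_lt ?_ (ht.trans_le le_top)
        refine le_trans ?_ (ENNReal.le_tsum n)
        simp [hne]
      -- A piece of finite `internalProb` must be coded: if no code served, the infimum would be
      -- `⊤`.
      by_contra! hcon
      refine hfin.not_ge (le_internalProb fun y c hy he hc => ?_)
      refine absurd (hcon y he.le) (not_lt.2 ?_)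
      rw [loebMeasure_apply (measurableSet_codeSet hh y), ← he]
      exact OuterMeasure.boundedBy_le _
  choose y hy₁ hy₂ using key
  refine ⟨y, hSt.trans (Set.iUnion_mono hy₁), ?_⟩
  exact (measure_iUnion_le _).trans ((ENNReal.tsum_le_tsum hy₂).trans ht.le)

/-! ### The map to the Cantor space -/

open Classical in
/-- The standard binary digits of a point of the hyperfinite space. -/
noncomputable def digits {h : HNat j} (x : Omega h.1) (i : ℕ) : Bool :=
  decide (HRel (fun a _ => a.testBit i = true) (toHNat x) (toHNat x))

/-- The length `n` is standard, so the star passes through the conjunction of `n` digit conditions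
one at a time. -/
theorem hRel_inCylinder {n : ℕ} {s : Finset ℕ} {x y : HNat j} :
    HRel (fun a _ => InCylinder n s a) x y ↔
      ∀ i < n, HRel (fun a _ => a.testBit i = true) x y ↔ i ∈ s := by
  induction n with
  | zero => simpa using hRel_of_forall (fun _ _ => by simp [InCylinder]) x y
  | succ n ih =>
    have e : (fun a (_ : ℕ) => InCylinder (n + 1) s a) =
        fun a _ => InCylinder n s a ∧ (a.testBit n = true ↔ n ∈ s) := by
      funext a _
      simp only [InCylinder, Nat.forall_lt_succ_right]
    rw [e, hRel_and, ih, Nat.forall_lt_succ_right]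
    refine and_congr_right fun _ => ?_
    by_cases hn : n ∈ s
    · simp [hn]
    · simp only [hn, iff_false]
      exact hRel_not

theorem digits_mem_cyl {h : HNat j} {n : ℕ} {s : Finset ℕ} {x : Omega h.1} :
    digits x ∈ cyl n s ↔ HRel (fun a _ => InCylinder n s a) (toHNat x) h := by
  rw [mem_cyl, show HRel (fun a _ => InCylinder n s a) (toHNat x) h ↔
    HRel (fun a _ => InCylinder n s a) (toHNat x) (toHNat x) from ⟨hRel_fst, hRel_fst⟩,
    hRel_inCylinder]
  simp [digits]

theorem exists_code_preimage_cyl (h : HNat j) (n : ℕ) (s : Finset ℕ) :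
    ∃ y : HNat j, ∀ x, HRel InBits x y ↔
      HRel InInterval x h ∧ HRel (fun a _ => InCylinder n s a) x h := by
  obtain ⟨w, hw⟩ := exists_code_interval h
  obtain ⟨y, hy⟩ := exists_code_separation (fun a _ => InCylinder n s a) w h
  exact ⟨y, fun x => by rw [hy, hw]⟩

theorem exists_code_preimage_cyl_compl (h : HNat j) (n : ℕ) (s : Finset ℕ) :
    ∃ y : HNat j, codeSet h y = digits ⁻¹' (cyl n s)ᶜ := by
  obtain ⟨w, hw⟩ := exists_code_interval h
  obtain ⟨y, hy⟩ := exists_code_separation (fun a _ => ¬ InCylinder n s a) w h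
  refine ⟨y, ?_⟩
  ext x
  rw [Set.mem_preimage, Set.mem_compl_iff, digits_mem_cyl, ← hRel_not]
  exact (hy _).trans (and_iff_right ((hw _).2 (toHNat_mem x)))

theorem digits_preimage_cyl {h y : HNat j} {n : ℕ} {s : Finset ℕ} (hy : ∀ x, HRel InBits x y ↔
      HRel InInterval x h ∧ HRel (fun a _ => InCylinder n s a) x h) :
    digits ⁻¹' cyl n s = codeSet h y := by
  ext x
  exact digits_mem_cyl.trans ((hy _).trans (and_iff_right (toHNat_mem x))).symm

theorem loebMeasure_preimage_cyl_le {h : HNat j} (hh : IsHyperfinite h.1) (n : ℕ)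
    (s : Finset ℕ) :
    loebMeasure h.1 (digits ⁻¹' cyl n s) ≤ 2 * 2⁻¹ ^ n := by
  obtain ⟨y, hy⟩ := exists_code_preimage_cyl h n s
  obtain ⟨c, hc⟩ := exists_hRel_cardBits y
  have hcode : IsCode h y := fun x hx => ((hy x).1 hx).1
  rw [digits_preimage_cyl hy]
  refine (loebMeasure_codeSet_le hh hcode hc).trans ?_
  -- The factor `2` comes from `b * 2 ^ n ≤ a + 2 ^ n ≤ 2 * a`; the last inequality holds because
  -- the hyperfinite `h` exceeds `2 ^ n`.
  have hr : stRatio c.1 h.1 ≤ 2 * (2⁻¹ : ℝ) ^ n := by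
    refine stRatio_le (by positivity) (hRel_and.2 ⟨hRel_fst (hh.le (2 ^ n)),
      hRel_card_cylinder hcode (fun x hx => hRel_fst ((hy x).1 hx).2) hc⟩) ?_
    rintro p q a b hq ⟨ha, hb⟩ hpq
    have hpos : 0 < a := lt_of_lt_of_le (by positivity) ha
    have : p * 2 ^ n * a ≤ 2 * q * a := by
      calc p * 2 ^ n * a = p * a * 2 ^ n := by ring
        _ ≤ q * b * 2 ^ n := Nat.mul_le_mul_right _ hpq
        _ = q * (b * 2 ^ n) := by ring
        _ ≤ q * (a + a) := Nat.mul_le_mul_left q (hb.trans (Nat.add_le_add_left ha a))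
        _ = 2 * q * a := by ring
    have : (p : ℝ) * 2 ^ n ≤ 2 * q := by exact_mod_cast Nat.le_of_mul_le_mul_right this hpos
    rw [inv_pow, ← div_eq_mul_inv, div_le_div_iff₀ (by positivity) (by positivity)]
    exact this
  refine (ENNReal.ofReal_le_ofReal hr).trans_eq ?_
  rw [ENNReal.ofReal_mul (by norm_num), ENNReal.ofReal_pow (by norm_num),
    ENNReal.ofReal_inv_of_pos (by norm_num)]
  simp

theorem measurable_digits {h : HNat j} (hh : IsHyperfinite h.1) :
    Measurable (digits : Omega h.1 → ℕ → Bool) := by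
  refine measurable_pi_iff.2 fun i => measurable_to_bool ?_
  obtain ⟨w, hw⟩ := exists_code_interval h
  obtain ⟨y, hy⟩ := exists_code_separation (fun a _ => a.testBit i = true) w h
  have : (fun x : Omega h.1 => digits x i) ⁻¹' {true} = codeSet h y := by
    ext x
    simp only [Set.mem_preimage, Set.mem_singleton_iff, digits, decide_eq_true_eq]
    refine Iff.trans ⟨hRel_fst, hRel_fst⟩ ((hy _).trans (and_iff_right ((hw _).2 (toHNat_mem x)))).symm
  rw [this]
  exact measurableSet_codeSet hh y

theorem absolutelyContinuous_map_digits {h : HNat j} (hh : IsHyperfinite h.1) :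
    (loebMeasure h.1).map digits ≪ coinMeasure := by
  have : IsProbabilityMeasure coinMeasure := by
    unfold coinMeasure
    infer_instance
  refine absolutelyContinuous_of_cyl (c := 2) (by simp) fun n s => ?_
  rw [Measure.map_apply (measurable_digits hh) (isOpen_cyl n s).measurableSet, coinMeasure_cyl]
  exact loebMeasure_preimage_cyl_le hh n s

end

/-! ### Ranks -/

theorem exists_ordinal_bound {κ : Cardinal.{u}} (hκ : κ.IsRegular) (hκω : ℵ₀ < κ) {ι : Type}
    [Countable ι] {f : ι → Ordinal.{u}} (hf : ∀ i, f i < κ.ord) :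
    ∃ α < κ.ord, ∀ i, f i ≤ α := by
  refine ⟨⨆ i, f i, ?_, fun i => Ordinal.le_iSup f i⟩
  refine Ordinal.lift_iSup_lt_of_lt_cof ?_ hf
  rw [Ordinal.lift_uzero, hκ.cof_ord]
  exact (Cardinal.lift_le_aleph0.2 (Cardinal.mk_le_aleph0 (α := ι))).trans_lt hκω

/-- A set of cardinality `lam` that is the union of a chain indexed by the cardinals below
`lam` is filtered by `cof lam` many small pieces, each contained in a suitable piece of the
chain. -/
theorem exists_rank {N : Type u} {κ lam : Cardinal.{u}} (hlam : ℵ₀ ≤ lam)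
    (hcof : lam.ord.cof = κ) (hN : #N = lam) {C : Cardinal.{u} → Set N}
    (hmono : ∀ μ ν, μ ≤ ν → ν < lam → C μ ⊆ C ν) (hC : ∀ x, ∃ μ < lam, x ∈ C μ) :
    ∃ ρ : N → Ordinal.{u}, (∀ x, ρ x < κ.ord) ∧
      ∀ β < κ.ord, ∃ μ < lam, {x | ρ x ≤ β} ⊆ C μ ∧ #{x | ρ x ≤ β} ≤ μ := by
  -- The rank of `x` will be the position, in a cofinal set of order type `κ.ord`, of a bound for
  -- both the index of `x` in an enumeration of `N` and a cardinal `m x` with `x ∈ C (m x)`. The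
  -- first controls the size of the pieces, the second their place in the chain.
  obtain ⟨s, hs, htype⟩ := Ordinal.exists_ord_cof_eq lam.ord.ToType
  rw [Ordinal.cof_toType, hcof] at htype
  obtain ⟨e⟩ : Nonempty (N ≃ lam.ord.ToType) := Cardinal.eq.1 (by rw [hN, Cardinal.mk_ord_toType])
  choose m hm hmC using hC
  let m' : N → lam.ord.ToType := fun x => Ordinal.ToType.mk ⟨(m x).ord, Cardinal.ord_lt_ord.2 (hm x)⟩
  have hex (x : N) : ∃ b : s, e x ≤ b ∧ m' x ≤ b := by
    obtain ⟨b, hb, hxb⟩ := hs (max (e x) (m' x))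
    exact ⟨⟨b, hb⟩, (le_max_left _ _).trans hxb, (le_max_right _ _).trans hxb⟩
  choose b hb₁ hb₂ using hex
  refine ⟨fun x => Ordinal.typein (α := s) (· < ·) (b x),
    fun x => htype ▸ Ordinal.typein_lt_type _ _, fun β hβ => ?_⟩
  let t : s := Ordinal.enum (α := s) (· < ·) ⟨β, htype.symm ▸ hβ⟩
  have htβ : Ordinal.typein (α := s) (· < ·) t = β := Ordinal.typein_enum _ _
  have ht {x : N} (hx : Ordinal.typein (α := s) (· < ·) (b x) ≤ β) : (b x : lam.ord.ToType) ≤ t := by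
    rw [← htβ, Ordinal.typein_le_typein, not_lt] at hx
    exact hx
  let γ := Ordinal.ToType.mk.symm (t : lam.ord.ToType)
  have hγ : γ.1.card < lam := Cardinal.lt_ord.1 γ.2
  have hIic : #(Set.Iic (t : lam.ord.ToType)) < lam := by
    rw [← Set.Iio_insert]
    exact Cardinal.mk_insert_le.trans_lt (Cardinal.add_lt_of_lt hlam
      ((Cardinal.mk_Iio_lt _ (by simp)).trans_eq (Cardinal.mk_ord_toType lam)) (Cardinal.one_lt_aleph0.trans_le hlam))
  refine ⟨max γ.1.card #(Set.Iic (t : lam.ord.ToType)), max_lt hγ hIic, fun x hx => ?_, ?_⟩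
  · refine hmono (m x) _ ?_ (max_lt hγ hIic) (hmC x)
    refine le_trans ?_ (le_max_left _ _)
    have : m' x ≤ t := (hb₂ x).trans (ht hx)
    rw [← OrderIso.le_symm_apply] at this
    rw [← Cardinal.ord_le]
    exact this
  · refine le_trans ?_ (le_max_right _ _)
    exact Cardinal.mk_le_of_injective (f := fun x => (⟨e x.1, (hb₁ x.1).trans (ht x.2)⟩ :
      Set.Iic (t : lam.ord.ToType))) fun x y h => Subtype.ext (e.injective (congrArg Subtype.val h))

section

variable {M : Type u} [memLang.Structure M] {j : Std ↪ₑ[memLang] M}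

/-! ### The special structure on the internal natural numbers -/

/-- The internal natural numbers with the membership relation between numbers and codes. -/
instance : memLang.Structure (HNat j) where
  funMap f := nomatch f
  RelMap | MemRel.mem => fun v => HRel InBits (v 0) (v 1)

theorem isInternallyPresented_hNat : IsInternallyPresented memLang (starNat j) := by
  refine ⟨?_, fun _ f => nomatch f⟩
  rintro _ ⟨⟩
  refine ⟨star j (stdRel InBits), fun v => ?_⟩
  constructor
  · rintro ⟨p, hp, h⟩
    exact ⟨p, ⟨_, rfl, hp⟩, h⟩
  · rintro ⟨p, ⟨_, rfl, hp⟩, h⟩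
    exact ⟨p, hp, h⟩

theorem card_memLang_lt : memLang.card < ℵ₀ := by
  have : Finite memLang.Symbols := by
    have : Finite (Σ n, memLang.Functions n) := by
      have : IsEmpty (Σ n, memLang.Functions n) := ⟨fun x => nomatch x.2⟩
      infer_instance
    have : Finite (Σ n, memLang.Relations n) := by
      have : Subsingleton (Σ n, memLang.Relations n) := ⟨by rintro ⟨_, ⟨⟩⟩ ⟨_, ⟨⟩⟩; rfl⟩
      infer_instance
    exact inferInstanceAs (Finite (_ ⊕ _))
  exact Cardinal.lt_aleph0_of_finite _

theorem mem_elementarySubstructure {S : memLang.ElementarySubstructure (HNat j)} {a b : S} :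
    Mem a b ↔ HRel InBits a.1 b.1 := Iff.rfl

/-- The formulas "the variable belongs to `y`" with `y ∈ Y` form a type over at most `μ` parameters,
which the saturated substructure realizes. -/
theorem exists_common_of_saturated {S : memLang.ElementarySubstructure (HNat j)}
    {μ : Cardinal.{u}} (hS : IsSaturatedModel memLang S (Order.succ μ)) {Y : Set (HNat j)}
    (hYS : ∀ y ∈ Y, y ∈ S) (hY : #Y ≤ μ)
    (hfin : ∀ F : Set (HNat j), F ⊆ Y → F.Finite → ∃ x : HNat j, ∀ y ∈ F, HRel InBits x y) :
    ∃ x : HNat j, ∀ y ∈ Y, HRel InBits x y := by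
  classical
  let X : Set S := {s | s.1 ∈ Y}
  have hX : #X < Order.succ μ := by
    refine Order.lt_succ_of_le (le_trans ?_ hY)
    exact Cardinal.mk_le_of_injective (f := fun x : X => (⟨x.1.1, x.2⟩ : Y)) fun x y h =>
      Subtype.ext (Subtype.ext (congrArg (fun z : Y => (z : HNat j)) h))
  let g : X → memLang.Formula (X ⊕ Unit) := fun x =>
    memForm (.var (Sum.inl (Sum.inr ()))) (.var (Sum.inl (Sum.inl x)))
  have hg (x : X) (a : S) : (g x).Realize (Sum.elim (fun x : X => (x : S)) fun _ => a) ↔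
      HRel InBits a.1 x.1.1 := by
    simp only [g, FirstOrder.Language.Formula.Realize, realize_memForm]
    exact mem_elementarySubstructure
  obtain ⟨a, ha⟩ := hS X hX (Set.range g) fun Δ hΔ => by
    rw [← Set.image_univ] at hΔ
    obtain ⟨F, -, rfl⟩ := Finset.subset_set_image_iff.1 hΔ
    -- The common element given by `hfin` need not lie in `S`; elementarity for this existential
    -- formula supplies one that does.
    let φ : memLang.Formula F := (FirstOrder.Language.Formula.iInf fun y : F =>
      (memForm (.var (Sum.inl (Sum.inr ()))) (.var (Sum.inl (Sum.inl y))) :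
        memLang.Formula (F ⊕ Unit))).iExs Unit
    have hφ {Q : Type u} [memLang.Structure Q] (v : F → Q) :
        φ.Realize v ↔ ∃ a : Q, ∀ y, Mem a (v y) := by
      simp only [φ, FirstOrder.Language.Formula.realize_iExs,
        FirstOrder.Language.Formula.realize_iInf]
      simp only [FirstOrder.Language.Formula.Realize, realize_memForm]
      exact ⟨fun ⟨a, h⟩ => ⟨a (), h⟩, fun ⟨a, h⟩ => ⟨fun _ => a, h⟩⟩
    obtain ⟨x, hx⟩ := hfin ((fun y : X => y.1.1) '' F)
      (by rintro _ ⟨y, -, rfl⟩; exact y.2) (F.finite_toSet.image _)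
    have h₁ := (hφ (S.subtype ∘ fun y : F => y.1.1)).2 ⟨x, fun y => hx _ ⟨y.1, y.2, rfl⟩⟩
    rw [S.subtype.map_formula, hφ] at h₁
    obtain ⟨a, ha⟩ := h₁
    refine ⟨a, fun ψ hψ => ?_⟩
    obtain ⟨y, hy, rfl⟩ := Finset.mem_image.1 hψ
    rw [hg]
    exact mem_elementarySubstructure.1 (ha ⟨y, hy⟩)
  refine ⟨a.1, fun y hy => ?_⟩
  exact (hg ⟨⟨y, hYS y hy⟩, hy⟩ a).1 (ha _ ⟨_, rfl⟩)

theorem exists_rank_of_special {κ lam : Cardinal.{u}} (hlam : ℵ₀ ≤ lam)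
    (hcof : lam.ord.cof = κ) (hspecial : SpecialModelAxiom j ℵ₀) (hcard : #(HNat j) = lam) :
    ∃ ρ : HNat j → Ordinal.{u}, (∀ y, ρ y < κ.ord) ∧
      ∀ β < κ.ord, ∀ Y : Set (HNat j), (∀ y ∈ Y, ρ y ≤ β) →
        (∀ F : Set (HNat j), F ⊆ Y → F.Finite → ∃ x : HNat j, ∀ y ∈ F, HRel InBits x y) →
        ∃ x : HNat j, ∀ y ∈ Y, HRel InBits x y := by
  have : Infinite (HNat j) := by rwa [Cardinal.infinite_iff, hcard]
  obtain ⟨C, hmono, hC, hsat⟩ :=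
    hspecial memLang card_memLang_lt (starNat j) isInternallyPresented_hNat
  rw [hcard] at hmono hC hsat
  obtain ⟨ρ, hρ, h⟩ := exists_rank hlam hcof hcard (C := fun μ => (C μ : Set (HNat j))) hmono hC
  refine ⟨ρ, hρ, fun β hβ Y hY hfin => ?_⟩
  obtain ⟨μ, hμ, hsub, hle⟩ := h β hβ
  exact exists_common_of_saturated (hsat μ hμ) (fun y hy => hsub (hY y hy))
    ((Cardinal.mk_le_mk_of_subset hY).trans hle) hfin

end

section

variable {M : Type u} [memLang.Structure M] {j : Std ↪ₑ[memLang] M}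

/-! ### The compact family -/

/-- The sets of the compact family: intersections of coded sets of bounded rank whose image in the
Cantor space is contained in a closed set that avoids the corresponding null set. -/
def compactFamily (h : HNat j) (κ : Cardinal.{u}) (Z : Ordinal.{u} → Set (ℕ → Bool))
    (ρ : HNat j → Ordinal.{u}) : Set (Set (Omega h.1)) :=
  {S | MeasurableSet S ∧ ∃ α < κ.ord, ∃ K : Set (ℕ → Bool), IsClosed K ∧ Disjoint K (Z α) ∧
    ∃ Y : Set (HNat j), (∀ y ∈ Y, ρ y ≤ α) ∧ S = (⋂ y ∈ Y, codeSet h y) ∧ S ⊆ digits ⁻¹' K}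

theorem isCompactFamily_compactFamily {h : HNat j} {κ : Cardinal.{u}}
    {Z : Ordinal.{u} → Set (ℕ → Bool)}
    (hZmono : ∀ α β : Ordinal.{u}, α ≤ β → β < κ.ord → Z α ⊆ Z β)
    (hZcover : ∀ f : ℕ → Bool, ∃ α < κ.ord, f ∈ Z α)
    {ρ : HNat j → Ordinal.{u}} (hρ : ∀ y, ρ y < κ.ord)
    (hsat : ∀ β < κ.ord, ∀ Y : Set (HNat j), (∀ y ∈ Y, ρ y ≤ β) →
      (∀ F : Set (HNat j), F ⊆ Y → F.Finite → ∃ x : HNat j, ∀ y ∈ F, HRel InBits x y) →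
      ∃ x : HNat j, ∀ y ∈ Y, HRel InBits x y) :
    IsCompactFamily (compactFamily h κ Z ρ) := by
  classical
  intro D hD hfip
  have hD' (S : D) := (hD S.2).2
  choose α hα K hK hKZ Y hY hSY hSK using hD'
  have hbound : ∃ β < κ.ord, ∀ S, α S ≤ β := by
    -- With unbounded ranks, a point common to all the closed sets would lie in no `Z β`, although
    -- the `Z β` cover the Cantor space.
    by_contra! hcon
    have hne : (⋂ S, K S).Nonempty := by
      refine CompactSpace.iInter_nonempty hK fun F => ?_
      obtain ⟨x, hx⟩ := hfip ((fun S : D => S.1) '' F) (by rintro _ ⟨S, -, rfl⟩; exact S.2)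
        (F.finite_toSet.image _)
      exact ⟨digits x, Set.mem_iInter₂.2 fun S hS => hSK S (hx _ ⟨S, hS, rfl⟩)⟩
    obtain ⟨f, hf⟩ := hne
    obtain ⟨β, hβ, hfβ⟩ := hZcover f
    obtain ⟨S, hS⟩ := hcon β hβ
    exact Set.disjoint_left.1 (hKZ S) (Set.mem_iInter.1 hf S) (hZmono _ _ hS.le (hα S) hfβ)
  obtain ⟨β, hβ, hαβ⟩ := hbound
  -- The code of `{1, …, h}` joins the family so that the element found by saturation is a point of
  -- the space.
  obtain ⟨y₀, hy₀⟩ := exists_code_interval h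
  obtain ⟨x, hx⟩ := hsat (max β (ρ y₀)) (max_lt hβ (hρ y₀)) (insert y₀ (⋃ S, Y S)) (by
      intro y hy
      rcases hy with rfl | hy
      · exact le_max_right _ _
      · obtain ⟨S, hS⟩ := Set.mem_iUnion.1 hy
        exact (hY S y hS).trans ((hαβ S).trans (le_max_left _ _)))
    (by
      intro F hF hFfin
      -- Finitely many codes involve only finitely many members of `D`, to which the finite
      -- intersection property applies.
      have hch (y : HNat j) : ∃ T : Set D, T.Finite ∧ (y ∈ F → y = y₀ ∨ ∃ S ∈ T, y ∈ Y S) := by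
        by_cases hy : y ∈ F
        · rcases hF hy with rfl | hy'
          · exact ⟨∅, Set.finite_empty, fun _ => Or.inl rfl⟩
          · obtain ⟨S, hS⟩ := Set.mem_iUnion.1 hy'
            exact ⟨{S}, Set.finite_singleton S, fun _ => Or.inr ⟨S, rfl, hS⟩⟩
        · exact ⟨∅, Set.finite_empty, fun h => absurd h hy⟩
      choose T hTfin hT using hch
      obtain ⟨x, hx⟩ := hfip ((fun S : D => S.1) '' ⋃ y ∈ F, T y)
        (by rintro _ ⟨S, -, rfl⟩; exact S.2)
        ((hFfin.biUnion fun y _ => hTfin y).image _)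
      refine ⟨toHNat x, fun y hy => ?_⟩
      rcases hT y hy with rfl | ⟨S, hST, hyS⟩
      · exact (hy₀ _).2 (toHNat_mem x)
      · have hxS : x ∈ S.1 := hx _ ⟨S, Set.mem_iUnion₂.2 ⟨y, hy, hST⟩, rfl⟩
        rw [hSY S] at hxS
        exact Set.mem_iInter₂.1 hxS y hyS)
  have hxh : HRel InInterval x h := (hy₀ x).1 (hx y₀ (Set.mem_insert _ _))
  refine ⟨⟨x.1, hxh⟩, fun S hS => ?_⟩
  refine (hSY ⟨S, hS⟩).superset (Set.mem_iInter₂.2 fun y hy => ?_)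
  exact hx y (Set.mem_insert_of_mem _ (Set.mem_iUnion.2 ⟨⟨S, hS⟩, hy⟩))

/-! ### Inner regularity -/

theorem exists_code_compl (h y : HNat j) : ∃ z : HNat j, codeSet h z = (codeSet h y)ᶜ := by
  obtain ⟨w, hw⟩ := exists_code_interval h
  obtain ⟨z, hz⟩ := exists_code_separation (fun a b => ¬ InBits a b) w y
  refine ⟨z, ?_⟩
  ext x
  rw [Set.mem_compl_iff]
  exact (hz _).trans ((and_iff_right ((hw _).2 (toHNat_mem x))).trans hRel_not)

/-- A closed set is the intersection of the complements of the basic sets disjoint from it. -/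
theorem iInter_compl_cyl_eq {K : Set (ℕ → Bool)} (hK : IsClosed K) :
    ⋂ p ∈ {p : ℕ × Finset ℕ | Disjoint (cyl p.1 p.2) K}, (cyl p.1 p.2)ᶜ = K := by
  refine Set.Subset.antisymm (fun f hf => ?_) fun f hf => ?_
  · by_contra hfK
    obtain ⟨n, hn⟩ := exists_cylinder_subset hK.isOpen_compl hfK
    obtain ⟨s, -, hs⟩ := exists_cyl_eq f n
    have hf' := PiNat.self_mem_cylinder f n
    rw [hs] at hn hf'
    exact Set.mem_iInter₂.1 hf (n, s) (Set.disjoint_left.2 hn) hf'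
  · exact Set.mem_iInter₂.2 fun p hp hfp => Set.disjoint_left.1 hp hfp hf

theorem exists_compactFamily_subset {h : HNat j} (hh : IsHyperfinite h.1) {κ : Cardinal.{u}}
    (hκ : κ.IsRegular) (hκω : ℵ₀ < κ) {Z : Ordinal.{u} → Set (ℕ → Bool)}
    (hZnull : ∀ α < κ.ord, coinMeasure (Z α) = 0)
    {ρ : HNat j → Ordinal.{u}} (hρ : ∀ y, ρ y < κ.ord) {A : Set (Omega h.1)}
    (hA : MeasurableSet A) {ε : ENNReal} (hε : ε ≠ 0) :
    ∃ S ∈ compactFamily h κ Z ρ, S ⊆ A ∧ loebMeasure h.1 A ≤ loebMeasure h.1 S + ε := by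
  have hfinite := isFiniteMeasure_loebMeasure hh
  have hε2 : ε / 2 ≠ 0 := by simpa using hε
  obtain ⟨y, hAy, hPy⟩ := exists_codeSet_cover hh hA.compl hε2
  choose z hz using fun n => exists_code_compl h (y n)
  choose u hu using fun p : ℕ × Finset ℕ => exists_code_preimage_cyl_compl h p.1 p.2
  -- The closed set `K` depends on `α`, so `α` must be fixed before it is known which cylinders `K`
  -- misses. The codes for all the countably many cylinders are therefore bounded together.
  obtain ⟨α, hα, hρα⟩ := exists_ordinal_bound hκ hκω (f := Sum.elim (ρ ∘ z) (ρ ∘ u))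
    (by rintro (n | p) <;> exact hρ _)
  obtain ⟨K, hK, hKZ, hνK⟩ := exists_isClosed_disjoint
    (absolutelyContinuous_map_digits hh (hZnull α hα)) hε2
  rw [Measure.map_apply (measurable_digits hh) hK.measurableSet.compl] at hνK
  let B := ⋃ n, codeSet h (y n)
  have hB : MeasurableSet B := MeasurableSet.iUnion fun n => measurableSet_codeSet hh _
  refine ⟨Bᶜ ∩ digits ⁻¹' K, ⟨hB.compl.inter (measurable_digits hh hK.measurableSet), α, hα, K, hK,
    hKZ, Set.range z ∪ u '' {p | Disjoint (cyl p.1 p.2) K}, ?_, ?_, Set.inter_subset_right⟩,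
    fun x hx => ?_, ?_⟩
  · rintro _ (⟨n, rfl⟩ | ⟨p, -, rfl⟩)
    · exact hρα (Sum.inl n)
    · exact hρα (Sum.inr p)
  -- Both factors are intersections of coded sets: `Bᶜ` by complementation, and `digits ⁻¹' K`
  -- because `K` is cut out by the complements of the cylinders it misses.
  · rw [Set.biInter_union, Set.biInter_range, Set.biInter_image]
    simp only [hz, hu]
    rw [← Set.preimage_iInter₂, iInter_compl_cyl_eq hK, ← Set.compl_iUnion]
  · by_contra hxA
    exact hx.1 (hAy hxA)
  · have hcov : A ⊆ (Bᶜ ∩ digits ⁻¹' K) ∪ ((B ∩ A) ∪ digits ⁻¹' Kᶜ) := by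
      intro x hx
      by_cases h1 : x ∈ B
      · exact Or.inr (Or.inl ⟨h1, hx⟩)
      · by_cases h2 : digits x ∈ K
        · exact Or.inl ⟨h1, h2⟩
        · exact Or.inr (Or.inr h2)
    -- `B ∩ A` is the excess of the cover `B` over `Aᶜ`; finiteness of the measure allows `Aᶜ` to be
    -- cancelled.
    have hBA : loebMeasure h.1 (B ∩ A) ≤ ε / 2 := by
      have h1 := measure_inter_add_sdiff (μ := loebMeasure h.1) B hA
      have h2 : B \ A = Aᶜ := by
        rw [Set.sdiff_eq]
        exact Set.inter_eq_right.2 hAy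
      rw [h2] at h1
      have h3 : loebMeasure h.1 (B ∩ A) + loebMeasure h.1 Aᶜ ≤ ε / 2 + loebMeasure h.1 Aᶜ := by
        rw [h1, add_comm (ε / 2)]
        exact hPy
      exact (ENNReal.add_le_add_iff_right (measure_ne_top _ _)).1 h3
    calc loebMeasure h.1 A
        ≤ loebMeasure h.1 (Bᶜ ∩ digits ⁻¹' K) +
          (loebMeasure h.1 (B ∩ A) + loebMeasure h.1 (digits ⁻¹' Kᶜ)) :=
          (measure_mono hcov).trans ((measure_union_le _ _).trans
            (add_le_add_right (measure_union_le _ _) _))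
      _ ≤ loebMeasure h.1 (Bᶜ ∩ digits ⁻¹' K) + (ε / 2 + ε / 2) := by gcongr
      _ = _ := by rw [ENNReal.add_halves]

end

end Loeb

theorem theorem6 {κ lam : Cardinal.{u}} (hκ : κ.IsRegular) (hκω : Cardinal.aleph0 < κ)
    (Z : Ordinal.{u} → Set (ℕ → Bool))
    (hZmono : ∀ α β : Ordinal.{u}, α ≤ β → β < κ.ord → Z α ⊆ Z β)
    (hZnull : ∀ α < κ.ord, Loeb.coinMeasure (Z α) = 0)
    (hZcover : ∀ f : ℕ → Bool, ∃ α < κ.ord, f ∈ Z α)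
    (hlam : lam.IsStrongLimit) (hcof : lam.ord.cof = κ)
    {M : Type u} [Loeb.memLang.Structure M] (j : Loeb.Std ↪ₑ[Loeb.memLang] M)
    (hV : Loeb.IsSaturatedNSU j)
    (hspecial : Loeb.SpecialModelAxiom j Cardinal.aleph0)
    (hcard : Cardinal.mk (Loeb.starNat j).El = lam)
    (H : Loeb.NSU j) (hH : Loeb.IsHyperfinite H) :
    Loeb.IsCompactMeasure (Loeb.loebMeasure H) := by
  have hω : Cardinal.aleph0 ≤ lam := by
    refine hκω.le.trans ?_
    rw [← hcof]
    exact Ordinal.cof_ord_le lam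
  obtain ⟨ρ, hρ, hsat⟩ := Loeb.exists_rank_of_special hω hcof hspecial hcard
  let h : Loeb.HNat j := ⟨H, hH.1⟩
  refine ⟨Loeb.compactFamily h κ Z ρ, fun S hS => hS.1,
    Loeb.isCompactFamily_compactFamily hZmono hZcover hρ hsat, fun A hA => ?_⟩
  refine le_antisymm (ENNReal.le_of_forall_pos_le_add fun ε hε _ => ?_)
    (iSup₂_le fun S hS => measure_mono hS.2)
  obtain ⟨S, hS, hSA, hle⟩ := Loeb.exists_compactFamily_subset (h := h) hH hκ hκω hZnull hρ hA
    (ENNReal.coe_ne_zero.2 hε.ne')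
  refine hle.trans (add_le_add_left ?_ _)
  exact le_iSup₂ (f := fun S (_ : S ∈ {S | S ∈ Loeb.compactFamily h κ Z ρ ∧ S ⊆ A}) =>
    Loeb.loebMeasure H S) S ⟨hS, hSA⟩
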